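/- Let $\mathcal Q=(\mathcal Q_0,\mathcal Q_1)$ be a finite quiver, $\mathbb F$ a field, $k=\mathbb F\mathcal Q_0$, $V=\mathbb F\mathcal Q_1$, let $R$ be a sub-$k$-bimodule of $V\otimes_kV=\mathbb F\mathcal Q_2$, and let $A=T_k(V)/(R)=\mathbb F\mathcal Q/(R)$ be the corresponding quadratic quiver algebra. Put $A^e=A\otimes_{\mathbb F}A^{op}$; $A$-bimodules (on which the left and right actions of $\mathbb F$ coincide) are regarded as $A^e$-modules. Set $W_0=k$, $W_1=V$ and $W_p=\bigcap_{i+2+j=p}V^{\otimes_k i}\otimes_kR\otimes_kV^{\otimes_k j}$ for $p\ge 2$. The Koszul complex $K(A)$ is the complex of $A$-bimodules with $A\otimes_kW_p\otimes_kA$ in homological degree $p\geq 0$ and with differential $$d(a\otimes x_1\cdots x_p\otimes a')=ax_1\otimes x_2\cdots x_p\otimes a'+(-1)^p\,a\otimes x_1\cdots x_{p-1}\otimes x_pa'.$$ For an $A$-bimodule $M$ and $p\in\mathbb Z$ let $\mathrm{HK}_p(A,M)=H_p(M\otimes_{A^e}K(A))$ and $\mathrm{HK}^p(A,M)=H^p(\mathrm{Hom}_{A^e}(K(A),M))$;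 these vanish for $p<0$. Let $n\ge 0$ be an integer and suppose that $A$ is Koszul complex Calabi–Yau of dimension $n$, that is, (i) $K(A)$ has length $n$, i.e. $n$ is the largest $p$ with $A\otimes_kW_p\otimes_kA\neq 0$; (ii) $\mathrm{RHom}_{A^e}(K(A),A^e)\cong K(A)[-n]$ in the bounded derived category $\mathcal D^b(A\text{-Bimod})$, where the bimodule structure on the left-hand side comes from the inner bimodule structure of $A^e$. Then for every $A$-bimodule $M$ and every $p\in\mathbb Z$, the $\mathbb F$-vector spaces $\mathrm{HK}^p(A,M)$ and $\mathrm{HK}_{n-p}(A,M)$ are isomorphic. -/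

import Mathlib

universe u

open CategoryTheory TensorProduct MulOpposite

noncomputable section

/-- The path algebra `F Q` of a quiver `Q` with finitely many vertices: the vector space with basis
all paths of `Q` (the trivial ones included).  For `x` in the path algebra and a path `p` from `a`
to `b`, the coefficient of `p` in `x` is `x a b p`. -/
def PathAlgebra (F : Type u) [Field F] (Q : Type u) [Quiver.{u} Q] : Type u :=
  ∀ a b : Q, Quiver.Path a b →₀ F

namespace PathAlgebra

variable (F : Type u) [Field F] {Q : Type u} [Quiver.{u} Q]

instance : AddCommGroup (PathAlgebra F Q) :=
  inferInstanceAs (AddCommGroup (∀ a b : Q, Quiver.Path a b →₀ F))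

instance : Module F (PathAlgebra F Q) :=
  inferInstanceAs (Module F (∀ a b : Q, Quiver.Path a b →₀ F))

@[ext]
theorem ext {x y : PathAlgebra F Q} (h : ∀ a b, x a b = y a b) : x = y :=
  funext fun a => funext fun b => h a b

@[simp] theorem add_apply (x y : PathAlgebra F Q) (a b : Q) : (x + y) a b = x a b + y a b := rfl
@[simp] theorem zero_apply (a b : Q) : (0 : PathAlgebra F Q) a b = 0 := rfl
@[simp] theorem smul_apply (c : F) (x : PathAlgebra F Q) (a b : Q) : (c • x) a b = c • x a b := rfl

/-- Concatenation of paths, extended bilinearly: a path `q` from `b` to `c` and a path `p` from `a`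
to `b` have as product `q p` the path "first `p`, then `q`". -/
def compLin (a b c : Q) :
    (Quiver.Path b c →₀ F) →ₗ[F] (Quiver.Path a b →₀ F) →ₗ[F] (Quiver.Path a c →₀ F) :=
  Finsupp.lift _ F _ fun q => Finsupp.lmapDomain F F fun p => p.comp q

@[simp]
theorem compLin_single (a b c : Q) (q : Quiver.Path b c) (p : Quiver.Path a b) (r s : F) :
    compLin F a b c (Finsupp.single q r) (Finsupp.single p s) =
      Finsupp.single (p.comp q) (r * s) := by
  simp [compLin, Finsupp.mapDomain_single]

theorem compLin_assoc (a b c d : Q) (x : Quiver.Path c d →₀ F) (y : Quiver.Path b c →₀ F)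
    (z : Quiver.Path a b →₀ F) :
    compLin F a b d (compLin F b c d x y) z = compLin F a c d x (compLin F a b c y z) := by
  induction x using Finsupp.induction_linear with
  | zero => simp
  | add f g hf hg => simp [hf, hg]
  | single p r =>
    induction y using Finsupp.induction_linear with
    | zero => simp
    | add f g hf hg => simp only [map_add, LinearMap.add_apply, hf, hg]
    | single q s =>
      induction z using Finsupp.induction_linear with
      | zero => simp
      | add f g hf hg => simp only [map_add, hf, hg]
      | single w t => simp only [compLin_single, mul_assoc, Quiver.Path.comp_assoc]

theorem compLin_nil_left (a b : Q) (z : Quiver.Path a b →₀ F) :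
    compLin F a b b (Finsupp.single Quiver.Path.nil 1) z = z := by
  induction z using Finsupp.induction_linear with
  | zero => simp
  | add f g hf hg => simp [hf, hg]
  | single w t => simp

theorem compLin_nil_right (a b : Q) (z : Quiver.Path a b →₀ F) :
    compLin F a a b z (Finsupp.single Quiver.Path.nil 1) = z := by
  induction z using Finsupp.induction_linear with
  | zero => simp
  | add f g hf hg => simp [hf, hg]
  | single w t => simp

theorem sum_apply {ι : Type*} (s : Finset ι) (f : ι → PathAlgebra F Q) (a b : Q) :
    (∑ i ∈ s, f i) a b = ∑ i ∈ s, f i a b := by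
  induction s using Finset.cons_induction with
  | empty => simp
  | cons i s hi ih => simp [ih]

theorem target_eq_of_comp_eq {s t t' c : Q} (p : Quiver.Path t' c) (q : Quiver.Path t c)
    (β : s ⟶ t') (α : s ⟶ t) (h : β.toPath.comp p = α.toPath.comp q) : t' = t := by
  induction p with
  | nil =>
    cases q with
    | nil => rfl
    | cons q f => simpa using congrArg Quiver.Path.length h
  | cons p e ih =>
    cases q with
    | nil => simpa using congrArg Quiver.Path.length h
    | cons q f =>
      have h1 := Quiver.Path.obj_eq_of_cons_eq_cons h
      subst h1
      exact ih q (eq_of_heq (Quiver.Path.heq_of_cons_eq_cons h))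

variable [Fintype Q]

/-- Products of paths are written from right to left: `x * y` is "first `y`, then `x`", and it is `0`
for paths that cannot be composed. -/
instance : Mul (PathAlgebra F Q) :=
  ⟨fun x y a c => ∑ b, compLin F a b c (x b c) (y a b)⟩

theorem mul_apply (x y : PathAlgebra F Q) (a c : Q) :
    (x * y) a c = ∑ b, compLin F a b c (x b c) (y a b) := rfl

variable [DecidableEq Q]

/-- The element of the path algebra whose only nonzero component is `f`, at `(a, b)`. -/
def component (a b : Q) : (Quiver.Path a b →₀ F) →ₗ[F] PathAlgebra F Q where
  toFun f := Pi.single a (Pi.single b f)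
  map_add' f g := by rw [Pi.single_add, Pi.single_add]; rfl
  map_smul' c f := by rw [Pi.single_smul, Pi.single_smul]; rfl

theorem component_apply (a b : Q) (f : Quiver.Path a b →₀ F) :
    component F a b f = Pi.single a (Pi.single b f) := rfl

/-- The path `p`, as an element of the path algebra. -/
def ofPath {a b : Q} (p : Quiver.Path a b) : PathAlgebra F Q :=
  Pi.single a (Pi.single b (Finsupp.single p 1))

/-- The idempotent `e_v` of the vertex `v`. -/
def vertex (v : Q) : PathAlgebra F Q := ofPath F (Quiver.Path.nil : Quiver.Path v v)


instance : One (PathAlgebra F Q) := ⟨∑ v, vertex F v⟩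

theorem one_apply (a b : Q) :
    (1 : PathAlgebra F Q) a b =
      (Pi.single a (Finsupp.single Quiver.Path.nil 1) : ∀ b : Q, Quiver.Path a b →₀ F) b := by
  change (∑ v, vertex F v) a b = _
  rw [sum_apply, Finset.sum_eq_single a]
  · simp [vertex, ofPath]
  · intro v _ h
    simp [vertex, ofPath, Pi.single_eq_of_ne h.symm]
  · simp

instance : Ring (PathAlgebra F Q) :=
  { (inferInstance : AddCommGroup (PathAlgebra F Q)) with
    mul := (· * ·)
    one := 1
    left_distrib := fun x y z => by ext1 a c; simp [mul_apply, Finset.sum_add_distrib]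
    right_distrib := fun x y z => by ext1 a c; simp [mul_apply, Finset.sum_add_distrib]
    zero_mul := fun x => by ext1 a c; simp [mul_apply]
    mul_zero := fun x => by ext1 a c; simp [mul_apply]
    mul_assoc := fun x y z => by
      ext1 a d
      simp only [mul_apply, map_sum, LinearMap.sum_apply, compLin_assoc]
      exact Finset.sum_comm
    one_mul := fun x => by
      ext1 a c
      rw [mul_apply, Finset.sum_eq_single c]
      · rw [one_apply, Pi.single_eq_same, compLin_nil_left]
      · intro b _ h
        rw [one_apply, Pi.single_eq_of_ne h.symm]; simp
      · simp
    mul_one := fun x => by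
      ext1 a c
      rw [mul_apply, Finset.sum_eq_single a]
      · rw [one_apply, Pi.single_eq_same, compLin_nil_right]
      · intro b _ h
        rw [one_apply, Pi.single_eq_of_ne h]; simp
      · simp }

instance : Algebra F (PathAlgebra F Q) :=
  Algebra.ofModule
    (fun r x y => by ext1 a c; simp [mul_apply, Finset.smul_sum])
    (fun r x y => by ext1 a c; simp [mul_apply, Finset.smul_sum])


theorem ofPath_mul_ofPath {a b c : Q} (q : Quiver.Path b c) (p : Quiver.Path a b) :
    ofPath F q * ofPath F p = ofPath F (p.comp q) := by
  ext1 a' c'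
  rw [mul_apply, Finset.sum_eq_single b]
  · by_cases ha : a' = a
    · subst ha
      by_cases hc : c' = c
      · subst hc
        simp only [ofPath, Pi.single_eq_same, compLin_single, mul_one]
      · simp [ofPath, Pi.single_eq_of_ne hc]
    · simp [ofPath, Pi.single_eq_of_ne ha]
  · intro b' _ hb
    simp [ofPath, Pi.single_eq_of_ne hb]
  · simp

theorem ofPath_mul_of_ne {a b b' c : Q} (q : Quiver.Path b c) (p : Quiver.Path a b')
    (h : b ≠ b') : ofPath F q * ofPath F p = 0 := by
  ext1 a' c'
  rw [mul_apply]
  refine Finset.sum_eq_zero fun d _ => ?_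
  by_cases hd : d = b
  · subst hd
    by_cases ha : a' = a
    · subst ha
      simp [ofPath, Pi.single_eq_of_ne h]
    · simp [ofPath, Pi.single_eq_of_ne ha]
  · simp [ofPath, Pi.single_eq_of_ne hd]

theorem vertex_mul_ofPath {a b : Q} (p : Quiver.Path a b) (v : Q) :
    vertex F v * ofPath F p = if v = b then ofPath F p else 0 := by
  split_ifs with h
  · subst h
    exact ofPath_mul_ofPath F _ _
  · exact ofPath_mul_of_ne F _ _ h

theorem ofPath_mul_vertex {a b : Q} (p : Quiver.Path a b) (v : Q) :
    ofPath F p * vertex F v = if a = v then ofPath F p else 0 := by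
  split_ifs with h
  · subst h
    rw [vertex, ofPath_mul_ofPath, Quiver.Path.nil_comp]
  · exact ofPath_mul_of_ne F _ _ h

/-- The span `F Q_m` of the paths of length `m`. -/
def pathsOfLength (m : ℕ) : Submodule F (PathAlgebra F Q) :=
  Submodule.span F {x | ∃ (a b : Q) (p : Quiver.Path a b), p.length = m ∧ x = ofPath F p}

theorem ofPath_mem {a b : Q} (p : Quiver.Path a b) : ofPath F p ∈ pathsOfLength F p.length :=
  Submodule.subset_span ⟨a, b, p, rfl, rfl⟩

theorem span_ofPath (x : PathAlgebra F Q) :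
    x ∈ Submodule.span F {x | ∃ (a b : Q) (p : Quiver.Path a b), x = ofPath F p} := by
  have key : x = ∑ a, ∑ b, component F a b (x a b) := by
    ext1 a b
    rw [sum_apply, Finset.sum_eq_single a, sum_apply, Finset.sum_eq_single b]
    · simp [component_apply]
    · intro b' _ h
      simp [component_apply, Pi.single_eq_of_ne h.symm]
    · simp
    · intro a' _ h
      rw [sum_apply]
      refine Finset.sum_eq_zero fun b' _ => ?_
      simp [component_apply, Pi.single_eq_of_ne h.symm]
    · simp
  rw [key]
  refine Submodule.sum_mem _ fun a _ => Submodule.sum_mem _ fun b _ => ?_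
  induction x a b using Finsupp.induction_linear with
  | zero => rw [map_zero]; exact zero_mem _
  | add f g hf hg =>
    rw [map_add]
    exact Submodule.add_mem _ hf hg
  | single p r =>
    have : component F a b (Finsupp.single p r) = r • ofPath F p := by
      rw [← mul_one r, ← smul_eq_mul, ← Finsupp.smul_single, map_smul]
      simp [ofPath, component_apply]
    rw [this]
    exact Submodule.smul_mem _ _ (Submodule.subset_span ⟨a, b, p, rfl⟩)

theorem induction_path {P : PathAlgebra F Q → Prop} (x : PathAlgebra F Q)
    (path : ∀ (a b : Q) (p : Quiver.Path a b), P (ofPath F p)) (zero : P 0)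
    (add : ∀ x y, P x → P y → P (x + y)) (smul : ∀ (c : F) x, P x → P (c • x)) : P x := by
  induction span_ofPath F x using Submodule.span_induction with
  | mem x h => obtain ⟨a, b, p, rfl⟩ := h; exact path a b p
  | zero => exact zero
  | add x y _ _ hx hy => exact add x y hx hy
  | smul c x _ hx => exact smul c x hx

theorem induction_length {m : ℕ} {P : PathAlgebra F Q → Prop} {x : PathAlgebra F Q}
    (hx : x ∈ pathsOfLength F m)
    (path : ∀ (a b : Q) (p : Quiver.Path a b), p.length = m → P (ofPath F p)) (zero : P 0)
    (add : ∀ x y, P x → P y → P (x + y)) (smul : ∀ (c : F) x, P x → P (c • x)) : P x := by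
  induction hx using Submodule.span_induction with
  | mem x h => obtain ⟨a, b, p, hp, rfl⟩ := h; exact path a b p hp
  | zero => exact zero
  | add x y _ _ hx hy => exact add x y hx hy
  | smul c x _ hx => exact smul c x hx

theorem mul_mem {m n : ℕ} {x y : PathAlgebra F Q} (hx : x ∈ pathsOfLength F m)
    (hy : y ∈ pathsOfLength F n) : x * y ∈ pathsOfLength F (m + n) := by
  refine induction_length F (P := fun x => x * y ∈ pathsOfLength F (m + n)) hx
    (fun a b p hp => ?_) (by simp) (fun x y h h' => ?_)
    (fun c x h => ?_)
  · refine induction_length F (P := fun y => ofPath F p * y ∈ pathsOfLength F (m + n)) hy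
      (fun a' b' q hq => ?_) (by simp) (fun x y h h' => ?_)
      (fun c x h => ?_)
    · by_cases h : a = b'
      · subst h
        rw [ofPath_mul_ofPath, ← hp, ← hq, add_comm, ← Quiver.Path.length_comp]
        exact ofPath_mem F _
      · rw [ofPath_mul_of_ne F _ _ h]
        exact zero_mem _
    · rw [mul_add]; exact add_mem h h'
    · rw [mul_smul_comm]; exact Submodule.smul_mem _ _ h
  · rw [add_mul]; exact add_mem h h'
  · rw [smul_mul_assoc]; exact Submodule.smul_mem _ _ h

theorem vertex_mem (v : Q) : vertex F v ∈ pathsOfLength F 0 :=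
  ofPath_mem F (Quiver.Path.nil : Quiver.Path v v)

theorem vertex_mul_mem (v : Q) {m : ℕ} {x : PathAlgebra F Q} (hx : x ∈ pathsOfLength F m) :
    vertex F v * x ∈ pathsOfLength F m := by
  simpa using mul_mem F (vertex_mem F v) hx

theorem mul_vertex_mem (v : Q) {m : ℕ} {x : PathAlgebra F Q} (hx : x ∈ pathsOfLength F m) :
    x * vertex F v ∈ pathsOfLength F m := by
  simpa using mul_mem F hx (vertex_mem F v)

/-- The arrows of `Q`; `α.1` is the source and `α.2.1` the target of `α`. -/
abbrev Arrow (Q : Type u) [Quiver.{u} Q] : Type u := Σ a b : Q, a ⟶ b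

/-- The arrow `α`, as an element of the path algebra. -/
def arrow (α : Arrow Q) : PathAlgebra F Q := ofPath F α.2.2.toPath

/-- Left cancellation of the arrow `α`: the path `α q` is sent to `q`, and the paths whose last
arrow (the leftmost factor) is not `α` are sent to `0`. -/
def lcut (α : Arrow Q) : PathAlgebra F Q →ₗ[F] PathAlgebra F Q where
  toFun x a := Pi.single α.1 (Finsupp.lcomapDomain (R := F)
    (fun p : Quiver.Path a α.1 => p.comp α.2.2.toPath)
    (Quiver.Path.comp_injective_left _) (x a α.2.1))
  map_add' x y := by
    funext a
    rw [add_apply, map_add, Pi.single_add]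
    rfl
  map_smul' c x := by
    funext a
    rw [smul_apply, map_smul, Pi.single_smul]
    rfl

/-- Right cancellation of the arrow `α`: the path `q α` is sent to `q`, and the paths whose first
arrow (the rightmost factor) is not `α` are sent to `0`. -/
def rcut (α : Arrow Q) : PathAlgebra F Q →ₗ[F] PathAlgebra F Q where
  toFun x := Pi.single α.2.1 fun c => Finsupp.lcomapDomain (R := F)
    (fun p : Quiver.Path α.2.1 c => α.2.2.toPath.comp p)
    (Quiver.Path.comp_injective_right _) (x α.1 c)
  map_add' x y := by
    refine (congrArg (Pi.single α.2.1) ?_).trans (Pi.single_add α.2.1 _ _)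
    funext c
    rw [add_apply, map_add]
    rfl
  map_smul' c x := by
    refine (congrArg (Pi.single α.2.1) ?_).trans (Pi.single_smul α.2.1 c _)
    funext d
    rw [smul_apply, map_smul]
    rfl

theorem lcut_apply (α : Arrow Q) (x : PathAlgebra F Q) (a : Q) :
    lcut F α x a = Pi.single α.1 (Finsupp.lcomapDomain (R := F)
    (fun p : Quiver.Path a α.1 => p.comp α.2.2.toPath)
    (Quiver.Path.comp_injective_left _) (x a α.2.1)) := rfl

theorem rcut_apply (α : Arrow Q) (x : PathAlgebra F Q) :
    rcut F α x = Pi.single α.2.1 fun c => Finsupp.lcomapDomain (R := F)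
    (fun p : Quiver.Path α.2.1 c => α.2.2.toPath.comp p)
    (Quiver.Path.comp_injective_right _) (x α.1 c) := rfl

theorem lcut_cons_self (α : Arrow Q) {a : Q} (p : Quiver.Path a α.1) :
    lcut F α (ofPath F (p.cons α.2.2)) = ofPath F p := by
  ext1 a' b'
  rw [lcut_apply]
  by_cases ha : a' = a
  · subst ha
    simp only [ofPath, Pi.single_eq_same]
    congr 1
    ext q
    simp [Quiver.Hom.toPath]
  · simp [ofPath, Pi.single_eq_of_ne ha]

theorem lcut_cons_ne (α β : Arrow Q) (h : α ≠ β) {a : Q} (p : Quiver.Path a β.1) :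
    lcut F α (ofPath F (p.cons β.2.2)) = 0 := by
  ext1 a' b'
  rw [lcut_apply]
  by_cases ha : a' = a
  · subst ha
    obtain ⟨s, t, α⟩ := α
    obtain ⟨s', t', β⟩ := β
    by_cases ht : t = t'
    · subst ht
      suffices H : Finsupp.lcomapDomain (R := F) (fun p : Quiver.Path a' s => p.comp α.toPath)
          (Quiver.Path.comp_injective_left _) (ofPath F (p.cons β) a' t) = 0 by
        simp only at H ⊢
        rw [H]
        simp
      ext q
      simp only [ofPath, Pi.single_eq_same, Finsupp.lcomapDomain_apply,
        Finsupp.comapDomain_apply, Finsupp.coe_zero, Pi.zero_apply]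
      refine Finsupp.single_eq_of_ne fun h' => ?_
      replace h' := h'.symm
      apply h
      have h1 := Quiver.Path.obj_eq_of_cons_eq_cons h'
      subst h1
      have h2 := Quiver.Path.hom_heq_of_cons_eq_cons h'
      rw [eq_of_heq h2]
    · simp [ofPath, Pi.single_eq_of_ne ht]
  · simp [ofPath, Pi.single_eq_of_ne ha]

theorem rcut_comp_self (α : Arrow Q) {c : Q} (p : Quiver.Path α.2.1 c) :
    rcut F α (ofPath F (α.2.2.toPath.comp p)) = ofPath F p := by
  rw [rcut_apply]
  unfold ofPath
  congr 1
  funext c'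
  by_cases hc : c' = c
  · subst hc
    simp only [Pi.single_eq_same]
    ext q
    simp
  · simp [Pi.single_eq_of_ne hc]

theorem rcut_comp_ne (α β : Arrow Q) (h : α ≠ β) {c : Q} (p : Quiver.Path β.2.1 c) :
    rcut F α (ofPath F (β.2.2.toPath.comp p)) = 0 := by
  rw [rcut_apply]
  suffices H : (fun c' => Finsupp.lcomapDomain (R := F)
      (fun p : Quiver.Path α.2.1 c' => α.2.2.toPath.comp p)
      (Quiver.Path.comp_injective_right _) (ofPath F (β.2.2.toPath.comp p) α.1 c')) = 0 by
    rw [H]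
    exact Pi.single_zero _
  funext c'
  obtain ⟨s, t, α⟩ := α
  obtain ⟨s', t', β⟩ := β
  by_cases hs : s = s'
  · subst hs
    by_cases hc : c' = c
    · subst hc
      ext q
      simp only [ofPath, Pi.single_eq_same, Finsupp.lcomapDomain_apply,
        Finsupp.comapDomain_apply, Finsupp.coe_zero, Pi.zero_apply]
      refine Finsupp.single_eq_of_ne fun h' => ?_
      replace h' := h'.symm
      apply h
      have hl : p.length = q.length := by
        have := congrArg Quiver.Path.length h'
        simpa using this
      have ht : t' = t := target_eq_of_comp_eq p q β α h'
      subst ht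
      have := ((Quiver.Path.comp_inj hl).1 h').1
      have h2 := Quiver.Path.hom_heq_of_cons_eq_cons this
      rw [eq_of_heq h2]
    · simp [ofPath, Pi.single_eq_of_ne hc]
  · simp [ofPath, Pi.single_eq_of_ne hs]


theorem exists_left {a b : Q} (p : Quiver.Path a b) {m : ℕ} (hp : p.length = m + 1) :
    ∃ (α : Arrow Q) (q : Quiver.Path a α.1), q.length = m ∧
      ofPath F p = ofPath F (q.cons α.2.2) := by
  cases p with
  | nil => simp at hp
  | cons q e => exact ⟨⟨_, _, e⟩, q, by simpa using hp, rfl⟩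

theorem exists_right {a b : Q} (p : Quiver.Path a b) {m : ℕ} (hp : p.length = m + 1) :
    ∃ (α : Arrow Q) (q : Quiver.Path α.2.1 b), q.length = m ∧
      ofPath F p = ofPath F (α.2.2.toPath.comp q) := by
  obtain ⟨c, f, q, hq, -, rfl⟩ := p.eq_toPath_comp_of_length_eq_succ hp
  exact ⟨⟨a, c, f⟩, q, hq, rfl⟩

theorem lcut_mem (α : Arrow Q) {m : ℕ} {x : PathAlgebra F Q} (hx : x ∈ pathsOfLength F (m + 1)) :
    lcut F α x ∈ pathsOfLength F m := by
  refine induction_length F (P := fun x => lcut F α x ∈ pathsOfLength F m) hx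
    (fun a b p hp => ?_) (by simp) (fun x y h h' => ?_) (fun c x h => ?_)
  · obtain ⟨β, q, rfl, h⟩ := exists_left F p hp
    rw [h]
    by_cases hαβ : α = β
    · subst hαβ
      rw [lcut_cons_self]
      exact ofPath_mem F _
    · rw [lcut_cons_ne F _ _ hαβ]
      exact zero_mem _
  · rw [map_add]; exact add_mem h h'
  · rw [map_smul]; exact Submodule.smul_mem _ _ h

theorem rcut_mem (α : Arrow Q) {m : ℕ} {x : PathAlgebra F Q} (hx : x ∈ pathsOfLength F (m + 1)) :
    rcut F α x ∈ pathsOfLength F m := by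
  refine induction_length F (P := fun x => rcut F α x ∈ pathsOfLength F m) hx
    (fun a b p hp => ?_) (by simp) (fun x y h h' => ?_) (fun c x h => ?_)
  · obtain ⟨β, q, rfl, h⟩ := exists_right F p hp
    rw [h]
    by_cases hαβ : α = β
    · subst hαβ
      rw [rcut_comp_self]
      exact ofPath_mem F _
    · rw [rcut_comp_ne F _ _ hαβ]
      exact zero_mem _
  · rw [map_add]; exact add_mem h h'
  · rw [map_smul]; exact Submodule.smul_mem _ _ h

theorem lcut_mul (α : Arrow Q) {m : ℕ} {x : PathAlgebra F Q} (hx : x ∈ pathsOfLength F (m + 1))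
    (y : PathAlgebra F Q) : lcut F α (x * y) = lcut F α x * y := by
  refine induction_length F (P := fun x => lcut F α (x * y) = lcut F α x * y) hx
    (fun a b p hp => ?_) (by simp) (fun x y h h' => ?_) (fun c x h => ?_)
  · obtain ⟨β, q, rfl, h⟩ := exists_left F p hp
    rw [h]
    refine induction_path F (P := fun y => lcut F α (ofPath F (q.cons β.2.2) * y) =
      lcut F α (ofPath F (q.cons β.2.2)) * y) y
      (fun a' b' p' => ?_) (by simp) (fun x y h h' => ?_) (fun c x h => ?_)
    · by_cases hab : a = b'
      · subst hab
        rw [ofPath_mul_ofPath, Quiver.Path.comp_cons]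
        by_cases hαβ : α = β
        · subst hαβ
          rw [lcut_cons_self, lcut_cons_self, ofPath_mul_ofPath]
        · rw [lcut_cons_ne F _ _ hαβ, lcut_cons_ne F _ _ hαβ, zero_mul]
      · rw [ofPath_mul_of_ne F _ _ hab, map_zero]
        by_cases hαβ : α = β
        · subst hαβ
          rw [lcut_cons_self, ofPath_mul_of_ne F _ _ hab]
        · rw [lcut_cons_ne F _ _ hαβ, zero_mul]
    · rw [mul_add, map_add, mul_add, h, h']
    · rw [mul_smul_comm, map_smul, mul_smul_comm, h]
  · rw [add_mul, map_add, map_add, add_mul, h, h']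
  · rw [smul_mul_assoc, map_smul, map_smul, smul_mul_assoc, h]

theorem rcut_mul (α : Arrow Q) {m : ℕ} {y : PathAlgebra F Q} (hy : y ∈ pathsOfLength F (m + 1))
    (x : PathAlgebra F Q) : rcut F α (x * y) = x * rcut F α y := by
  refine induction_length F (P := fun y => rcut F α (x * y) = x * rcut F α y) hy
    (fun a b p hp => ?_) (by simp) (fun x y h h' => ?_) (fun c x h => ?_)
  · obtain ⟨β, q, rfl, h⟩ := exists_right F p hp
    rw [h]
    refine induction_path F (P := fun x => rcut F α (x * ofPath F (β.2.2.toPath.comp q)) =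
      x * rcut F α (ofPath F (β.2.2.toPath.comp q))) x
      (fun a' b' p' => ?_) (by simp) (fun x y h h' => ?_) (fun c x h => ?_)
    · by_cases hab : a' = b
      · subst hab
        rw [ofPath_mul_ofPath, Quiver.Path.comp_assoc]
        by_cases hαβ : α = β
        · subst hαβ
          rw [rcut_comp_self, rcut_comp_self, ofPath_mul_ofPath]
        · rw [rcut_comp_ne F _ _ hαβ, rcut_comp_ne F _ _ hαβ, mul_zero]
      · rw [ofPath_mul_of_ne F _ _ hab, map_zero]
        by_cases hαβ : α = β
        · subst hαβ
          rw [rcut_comp_self, ofPath_mul_of_ne F _ _ hab]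
        · rw [rcut_comp_ne F _ _ hαβ, mul_zero]
    · rw [add_mul, map_add, add_mul, h, h']
    · rw [smul_mul_assoc, map_smul, smul_mul_assoc, h]
  · rw [mul_add, map_add, map_add, mul_add, h, h']
  · rw [mul_smul_comm, map_smul, map_smul, mul_smul_comm, h]

theorem lcut_rcut (α β : Arrow Q) {m : ℕ} {x : PathAlgebra F Q}
    (hx : x ∈ pathsOfLength F (m + 2)) :
    lcut F α (rcut F β x) = rcut F β (lcut F α x) := by
  refine induction_length F (P := fun x => lcut F α (rcut F β x) = rcut F β (lcut F α x)) hx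
    (fun a b p hp => ?_) (by simp) (fun x y h h' => ?_) (fun c x h => ?_)
  · obtain ⟨γ, q, hq, h⟩ := exists_left F p hp
    have h1 : ofPath F p = arrow F γ * ofPath F q := by
      rw [h, arrow, ofPath_mul_ofPath]; rfl
    have hγ : arrow F γ ∈ pathsOfLength F (0 + 1) := ofPath_mem F γ.2.2.toPath
    have hq' : ofPath F q ∈ pathsOfLength F (m + 1) := hq ▸ ofPath_mem F q
    rw [h1, rcut_mul F β hq', lcut_mul F α hγ, lcut_mul F α hγ, rcut_mul F β hq']
  · simp only [map_add, h, h']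
  · simp only [map_smul, h]

theorem lcut_vertex_mul (α : Arrow Q) (v : Q) {m : ℕ} {x : PathAlgebra F Q}
    (hx : x ∈ pathsOfLength F (m + 1)) :
    lcut F α (vertex F v * x) = if v = α.2.1 then lcut F α x else 0 := by
  refine induction_length F
    (P := fun x => lcut F α (vertex F v * x) = if v = α.2.1 then lcut F α x else 0) hx
    (fun a b p hp => ?_) (by simp) (fun x y h h' => ?_) (fun c x h => ?_)
  · obtain ⟨β, q, hq, h⟩ := exists_left F p hp
    rw [h, vertex_mul_ofPath]
    by_cases hαβ : α = β
    · subst hαβ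
      split_ifs <;> simp
    · rw [lcut_cons_ne F _ _ hαβ]
      split_ifs <;> simp [lcut_cons_ne F _ _ hαβ]
  · rw [mul_add, map_add, map_add, h, h']
    split_ifs <;> simp
  · rw [mul_smul_comm, map_smul, map_smul, h]
    split_ifs <;> simp

theorem rcut_mul_vertex (α : Arrow Q) (v : Q) {m : ℕ} {x : PathAlgebra F Q}
    (hx : x ∈ pathsOfLength F (m + 1)) :
    rcut F α (x * vertex F v) = if α.1 = v then rcut F α x else 0 := by
  refine induction_length F
    (P := fun x => rcut F α (x * vertex F v) = if α.1 = v then rcut F α x else 0) hx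
    (fun a b p hp => ?_) (by simp) (fun x y h h' => ?_) (fun c x h => ?_)
  · obtain ⟨β, q, hq, h⟩ := exists_right F p hp
    rw [h, ofPath_mul_vertex]
    by_cases hαβ : α = β
    · subst hαβ
      split_ifs <;> simp
    · rw [rcut_comp_ne F _ _ hαβ]
      split_ifs <;> simp [rcut_comp_ne F _ _ hαβ]
  · rw [add_mul, map_add, map_add, h, h']
    split_ifs <;> simp
  · rw [smul_mul_assoc, map_smul, map_smul, h]
    split_ifs <;> simp

theorem vertex_mul_lcut (α : Arrow Q) {m : ℕ} {x : PathAlgebra F Q}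
    (hx : x ∈ pathsOfLength F (m + 1)) : vertex F α.1 * lcut F α x = lcut F α x := by
  refine induction_length F (P := fun x => vertex F α.1 * lcut F α x = lcut F α x) hx
    (fun a b p hp => ?_) (by simp) (fun x y h h' => ?_) (fun c x h => ?_)
  · obtain ⟨β, q, hq, h⟩ := exists_left F p hp
    rw [h]
    by_cases hαβ : α = β
    · subst hαβ
      rw [lcut_cons_self, vertex_mul_ofPath, if_pos rfl]
    · rw [lcut_cons_ne F _ _ hαβ, mul_zero]
  · rw [map_add, mul_add, h, h']
  · rw [map_smul, mul_smul_comm, h]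

theorem rcut_mul_vertex_self (α : Arrow Q) {m : ℕ} {x : PathAlgebra F Q}
    (hx : x ∈ pathsOfLength F (m + 1)) : rcut F α x * vertex F α.2.1 = rcut F α x := by
  refine induction_length F (P := fun x => rcut F α x * vertex F α.2.1 = rcut F α x) hx
    (fun a b p hp => ?_) (by simp) (fun x y h h' => ?_) (fun c x h => ?_)
  · obtain ⟨β, q, hq, h⟩ := exists_right F p hp
    rw [h]
    by_cases hαβ : α = β
    · subst hαβ
      rw [rcut_comp_self, ofPath_mul_vertex, if_pos rfl]
    · rw [rcut_comp_ne F _ _ hαβ, zero_mul]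
  · rw [map_add, add_mul, h, h']
  · rw [map_smul, smul_mul_assoc, h]

variable [∀ a b : Q, Fintype (a ⟶ b)]

theorem sum_arrow_mul_lcut {m : ℕ} {x : PathAlgebra F Q} (hx : x ∈ pathsOfLength F (m + 1)) :
    ∑ α : Arrow Q, arrow F α * lcut F α x = x := by
  refine induction_length F (P := fun x => ∑ α : Arrow Q, arrow F α * lcut F α x = x) hx
    (fun a b p hp => ?_) (by simp) (fun x y h h' => ?_) (fun c x h => ?_)
  · obtain ⟨β, q, hq, h⟩ := exists_left F p hp
    rw [h, Finset.sum_eq_single β]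
    · rw [lcut_cons_self, arrow, ofPath_mul_ofPath]
      rfl
    · intro α _ hα
      rw [lcut_cons_ne F _ _ hα, mul_zero]
    · simp
  · simp only [map_add, mul_add, Finset.sum_add_distrib, h, h']
  · simp only [map_smul, mul_smul_comm, ← Finset.smul_sum, h]

theorem sum_rcut_mul_arrow {m : ℕ} {x : PathAlgebra F Q} (hx : x ∈ pathsOfLength F (m + 1)) :
    ∑ α : Arrow Q, rcut F α x * arrow F α = x := by
  refine induction_length F (P := fun x => ∑ α : Arrow Q, rcut F α x * arrow F α = x) hx
    (fun a b p hp => ?_) (by simp) (fun x y h h' => ?_) (fun c x h => ?_)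
  · obtain ⟨β, q, hq, h⟩ := exists_right F p hp
    rw [h, Finset.sum_eq_single β]
    · rw [rcut_comp_self, arrow, ofPath_mul_ofPath]
    · intro α _ hα
      rw [rcut_comp_ne F _ _ hα, zero_mul]
    · simp
  · simp only [map_add, add_mul, Finset.sum_add_distrib, h, h']
  · simp only [map_smul, smul_mul_assoc, ← Finset.smul_sum, h]

end PathAlgebra

/-- The cochain complex obtained by applying a contravariant additive functor `G` to `X`, with
`G (X^{-i})` in degree `i` and the Koszul sign in the differential `f ↦ -(-1)^i f ∘ d`. -/
def contravariantComplex {C : Type*} [Category* C] [Preadditive C] {D : Type*} [Category* D]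
    [Preadditive D] (G : Cᵒᵖ ⥤ D) [G.Additive] (X : CochainComplex C ℤ) : CochainComplex D ℤ where
  X i := G.obj (Opposite.op (X.X (-i)))
  d i j := (i + 1).negOnePow • G.map (X.d (-j) (-i)).op
  shape i j h := by
    rw [X.shape, Limits.op_zero, G.map_zero, smul_zero]
    simp only [ComplexShape.up_Rel] at h ⊢
    omega
  d_comp_d' i j k _ _ := by
    rw [Linear.units_smul_comp, Linear.comp_units_smul, ← G.map_comp, ← op_comp, X.d_comp_d,
      Limits.op_zero, G.map_zero, smul_zero, smul_zero]

/-- A space `R` of homogeneous quadratic relations on the quiver `Q`: a sub-`k`-bimodule of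
`V ⊗_k V = F Q_2`, where `k = F Q_0` is spanned by the vertices and `V = F Q_1` by the arrows. -/
structure QuadraticRelations (F : Type u) [Field F] (Q : Type u) [Quiver.{u} Q] [Fintype Q]
    [DecidableEq Q] where
  R : Submodule F (PathAlgebra F Q)
  le_two : R ≤ PathAlgebra.pathsOfLength F 2
  vertex_mul_mem : ∀ (v : Q), ∀ r ∈ R, PathAlgebra.vertex F v * r ∈ R
  mul_vertex_mem : ∀ (v : Q), ∀ r ∈ R, r * PathAlgebra.vertex F v ∈ R

namespace QuadraticRelations

open PathAlgebra

variable {F : Type u} [Field F] {Q : Type u} [Quiver.{u} Q] [Fintype Q] [DecidableEq Q]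
  (S : QuadraticRelations F Q)

/-- The quadratic algebra `A = T_k(V) / (R) = F Q / (R)`, where `(R)` is the two-sided ideal
generated by `R`. -/
def Alg : Type u := (TwoSidedIdeal.span (S.R : Set (PathAlgebra F Q))).ringCon.Quotient

instance : Ring S.Alg :=
  inferInstanceAs (Ring (TwoSidedIdeal.span (S.R : Set (PathAlgebra F Q))).ringCon.Quotient)

instance : Algebra F S.Alg :=
  inferInstanceAs (Algebra F (TwoSidedIdeal.span (S.R : Set (PathAlgebra F Q))).ringCon.Quotient)

/-- The projection `F Q → A`. -/
def proj : PathAlgebra F Q →ₐ[F] S.Alg :=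
  { (TwoSidedIdeal.span (S.R : Set (PathAlgebra F Q))).ringCon.mk' with
    commutes' := fun _ => rfl }

theorem proj_eq_zero {r : PathAlgebra F Q} (hr : r ∈ S.R) : S.proj r = 0 := by
  have h : r ∈ TwoSidedIdeal.span (S.R : Set (PathAlgebra F Q)) := TwoSidedIdeal.subset_span hr
  exact (RingCon.eq _).2 ((TwoSidedIdeal.mem_iff _ _).1 h)

/-- The enveloping algebra `A^e = A ⊗_F A^op`.  An `A`-bimodule (with equal left and right actions of
`F`) is a left `A^e`-module, with `(a ⊗ b^op) m = a m b`. -/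
def Env : Type u := S.Alg ⊗[F] S.Algᵐᵒᵖ

instance : Ring S.Env := inferInstanceAs (Ring (S.Alg ⊗[F] S.Algᵐᵒᵖ))

instance : Algebra F S.Env := inferInstanceAs (Algebra F (S.Alg ⊗[F] S.Algᵐᵒᵖ))

/-- The element `a ⊗ b^op` of the enveloping algebra. -/
def envMk (a b : S.Alg) : S.Env := (a ⊗ₜ op b : S.Alg ⊗[F] S.Algᵐᵒᵖ)

theorem envMk_mul (a b a' b' : S.Alg) :
    S.envMk a b * S.envMk a' b' = S.envMk (a * a') (b' * b) :=
  Algebra.TensorProduct.tmul_mul_tmul a a' (op b) (op b')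

theorem envMk_one : S.envMk 1 1 = 1 := rfl

/-- The spaces `W_p`, inside `V^{⊗_k p} = F Q_p`.  For `p ≥ 2` this is the intersection of all
`V^{⊗ i} ⊗_k R ⊗_k V^{⊗ j}` with `i + 2 + j = p` (tensor products over `k` are products in `F Q`);
for `p = 0, 1` the intersection is empty and `W_0 = k`, `W_1 = V`. -/
def W (p : ℕ) : Submodule F (PathAlgebra F Q) :=
  pathsOfLength F p ⊓
    ⨅ (i : ℕ) (j : ℕ) (_ : i + 2 + j = p), pathsOfLength F i * S.R * pathsOfLength F j

variable {S}

theorem mem_W {p : ℕ} {x : PathAlgebra F Q} :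
    x ∈ S.W p ↔ x ∈ pathsOfLength F p ∧
      ∀ i j, i + 2 + j = p → x ∈ pathsOfLength F i * S.R * pathsOfLength F j := by
  simp [W, Submodule.mem_iInf]

theorem W_le (p : ℕ) : S.W p ≤ pathsOfLength F p := fun _ h => (mem_W.1 h).1

theorem linearMap_mem {P : Submodule F (PathAlgebra F Q)} {x : PathAlgebra F Q}
    (f : PathAlgebra F Q →ₗ[F] PathAlgebra F Q) {i j : ℕ}
    (hx : x ∈ pathsOfLength F i * S.R * pathsOfLength F j)
    (h : ∀ a ∈ pathsOfLength F i, ∀ r ∈ S.R, ∀ b ∈ pathsOfLength F j, f (a * r * b) ∈ P) :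
    f x ∈ P := by
  have : pathsOfLength F i * S.R * pathsOfLength F j ≤ P.comap f := by
    rw [mul_assoc, Submodule.mul_le]
    intro a ha y hy
    have : S.R * pathsOfLength F j ≤ (P.comap f).comap (LinearMap.mulLeft F a) := by
      rw [Submodule.mul_le]
      intro r hr b hb
      simpa [mul_assoc] using h a ha r hr b hb
    exact this hy
  exact this hx

theorem mul_mul_mem {a r b : PathAlgebra F Q} {i j : ℕ} (ha : a ∈ pathsOfLength F i)
    (hr : r ∈ S.R) (hb : b ∈ pathsOfLength F j) :
    a * r * b ∈ pathsOfLength F i * S.R * pathsOfLength F j :=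
  Submodule.mul_mem_mul (Submodule.mul_mem_mul ha hr) hb

theorem vertex_mul_mem_W (v : Q) {p : ℕ} {x : PathAlgebra F Q} (hx : x ∈ S.W p) :
    vertex F v * x ∈ S.W p := by
  rw [mem_W] at hx ⊢
  refine ⟨PathAlgebra.vertex_mul_mem F v hx.1, fun i j h => ?_⟩
  refine linearMap_mem (LinearMap.mulLeft F (vertex F v)) (hx.2 i j h) fun a ha r hr b hb => ?_
  simpa [mul_assoc] using mul_mul_mem (PathAlgebra.vertex_mul_mem F v ha) hr hb

theorem mul_vertex_mem_W (v : Q) {p : ℕ} {x : PathAlgebra F Q} (hx : x ∈ S.W p) :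
    x * vertex F v ∈ S.W p := by
  rw [mem_W] at hx ⊢
  refine ⟨PathAlgebra.mul_vertex_mem F v hx.1, fun i j h => ?_⟩
  refine linearMap_mem (LinearMap.mulRight F (vertex F v)) (hx.2 i j h) fun a ha r hr b hb => ?_
  simpa [mul_assoc] using mul_mul_mem ha hr (PathAlgebra.mul_vertex_mem F v hb)

theorem lcut_mem_W (α : Arrow Q) {p : ℕ} {x : PathAlgebra F Q} (hx : x ∈ S.W (p + 1)) :
    lcut F α x ∈ S.W p := by
  rw [mem_W] at hx ⊢
  refine ⟨PathAlgebra.lcut_mem F α hx.1, fun i j h => ?_⟩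
  refine linearMap_mem (lcut F α) (hx.2 (i + 1) j (by omega)) fun a ha r hr b hb => ?_
  rw [mul_assoc a r b, lcut_mul F α ha, ← mul_assoc (lcut F α a)]
  exact mul_mul_mem (PathAlgebra.lcut_mem F α ha) hr hb

theorem rcut_mem_W (α : Arrow Q) {p : ℕ} {x : PathAlgebra F Q} (hx : x ∈ S.W (p + 1)) :
    rcut F α x ∈ S.W p := by
  rw [mem_W] at hx ⊢
  refine ⟨PathAlgebra.rcut_mem F α hx.1, fun i j h => ?_⟩
  refine linearMap_mem (rcut F α) (hx.2 i (j + 1) (by omega)) fun a ha r hr b hb => ?_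
  rw [rcut_mul F α hb]
  exact mul_mul_mem ha hr (PathAlgebra.rcut_mem F α hb)

variable (S)

/-- Left cancellation of `α` as a map `W_{p+1} → W_p`. -/
def lcutW (α : Arrow Q) (p : ℕ) : S.W (p + 1) →ₗ[F] S.W p :=
  (lcut F α).restrict fun _ h => lcut_mem_W α h

/-- Right cancellation of `α` as a map `W_{p+1} → W_p`. -/
def rcutW (α : Arrow Q) (p : ℕ) : S.W (p + 1) →ₗ[F] S.W p :=
  (rcut F α).restrict fun _ h => rcut_mem_W α h

/-- The map `w ↦ e_v w e_{v'}` on `W_p`. -/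
def vertexW (v v' : Q) (p : ℕ) : S.W p →ₗ[F] S.W p :=
  ((LinearMap.mulRight F (vertex F v')).comp (LinearMap.mulLeft F (vertex F v))).restrict
    fun _ h => mul_vertex_mem_W v' (vertex_mul_mem_W v h)


/-- The image of `x ⊗ y^op` in the enveloping algebra. -/
def env (x y : PathAlgebra F Q) : S.Env := S.envMk (S.proj x) (S.proj y)

theorem env_mul (x y x' y' : PathAlgebra F Q) :
    S.env x y * S.env x' y' = S.env (x * x') (y' * y) := by
  simp only [env, envMk_mul, map_mul]

/-- The `A^e`-submodule of `A^e ⊗_F W_p` generated by the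
`(e_v ⊗ e_{v'}^op) ⊗ w - 1 ⊗ e_v w e_{v'}`.  With `(a ⊗ b^op) ⊗ w` read as `a ⊗ w ⊗ b`, these are
the relations that turn `A ⊗_F W_p ⊗_F A` into `A ⊗_k W_p ⊗_k A`. -/
def balanced (p : ℕ) : Submodule S.Env (S.Env ⊗[F] S.W p) :=
  Submodule.span S.Env
    {z | ∃ (v v' : Q) (w : S.W p), z = S.env (vertex F v) (vertex F v') ⊗ₜ w -
      1 ⊗ₜ S.vertexW v v' p w}

/-- The `A`-bimodule `A ⊗_k W_p ⊗_k A`. -/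
abbrev KoszulModule (p : ℕ) : Type u := (S.Env ⊗[F] S.W p) ⧸ S.balanced p

/-- The class of `c ⊗ w`; for `c = a ⊗ b^op` this is the element `a ⊗_k w ⊗_k b`. -/
def tens (p : ℕ) (c : S.Env) : S.W p →ₗ[F] S.KoszulModule p :=
  ((S.balanced p).mkQ.restrictScalars F).comp (TensorProduct.mk F S.Env (S.W p) c)

theorem smul_tens (p : ℕ) (c c' : S.Env) (w : S.W p) :
    c • S.tens p c' w = S.tens p (c * c') w := rfl

theorem tens_balanced (p : ℕ) (v v' : Q) (w : S.W p) :
    S.tens p (S.env (vertex F v) (vertex F v')) w = S.tens p 1 (S.vertexW v v' p w) :=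
  (Submodule.Quotient.eq _).2 (Submodule.subset_span ⟨v, v', w, rfl⟩)

theorem tens_mul_balanced (p : ℕ) (c : S.Env) (v v' : Q) (w : S.W p) :
    S.tens p (c * S.env (vertex F v) (vertex F v')) w = S.tens p c (S.vertexW v v' p w) := by
  rw [← smul_tens, tens_balanced, smul_tens, mul_one]

theorem vertex_mul_arrow (v : Q) (α : Arrow Q) :
    vertex F v * arrow F α = if v = α.2.1 then arrow F α else 0 := vertex_mul_ofPath F _ _

theorem arrow_mul_vertex (α : Arrow Q) (v : Q) :
    arrow F α * vertex F v = if α.1 = v then arrow F α else 0 := ofPath_mul_vertex F _ _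

theorem tens_zero_left (p : ℕ) (w : S.W p) : S.tens p 0 w = 0 := by
  rw [← zero_smul S.Env (S.tens p 1 w), smul_tens, zero_mul]

theorem env_zero_left (y : PathAlgebra F Q) : S.env 0 y = 0 := by
  simp only [env, map_zero]
  exact TensorProduct.zero_tmul _ _

theorem env_zero_right (x : PathAlgebra F Q) : S.env x 0 = 0 := by
  simp only [env, map_zero]
  exact TensorProduct.tmul_zero _ _

/-- The anti-automorphism `a ⊗ b^op ↦ b ⊗ a^op` of `A^e`. -/
def envSwap : S.Env →ₐ[F] S.Envᵐᵒᵖ :=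
  show S.Alg ⊗[F] S.Algᵐᵒᵖ →ₐ[F] (S.Alg ⊗[F] S.Algᵐᵒᵖ)ᵐᵒᵖ from
  ((Algebra.TensorProduct.opAlgEquiv F F S.Alg S.Algᵐᵒᵖ).toAlgHom.comp
    (Algebra.TensorProduct.map (AlgHom.id F S.Algᵐᵒᵖ) (AlgEquiv.opOp F S.Alg).toAlgHom)).comp
    (Algebra.TensorProduct.comm F S.Alg S.Algᵐᵒᵖ).toAlgHom

theorem envSwap_envMk (a b : S.Alg) : S.envSwap (S.envMk a b) = op (S.envMk b a) := rfl

open ModuleCat in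
/-- The relations `m c ⊗ n - m ⊗ c n`, where the right action of `c = a ⊗ b^op` on the bimodule `M` is
`m c = b m a`. -/
def tensorRel (M N : ModuleCat.{u} S.Env) : Submodule F (M ⊗[F] N) :=
  Submodule.span F {z | ∃ (c : S.Env) (m : M) (n : N),
    z = ((S.envSwap c).unop • m) ⊗ₜ n - m ⊗ₜ (c • n)}

open ModuleCat in
/-- The functor `M ⊗_{A^e} -` from `A`-bimodules to vector spaces. -/
def tensorFunctor (M : ModuleCat.{u} S.Env) : ModuleCat.{u} S.Env ⥤ ModuleCat.{u} F where
  obj N := ModuleCat.of F ((M ⊗[F] N) ⧸ S.tensorRel M N)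
  map {N N'} f := ModuleCat.ofHom <| (S.tensorRel M N).mapQ (S.tensorRel M N')
    (LinearMap.lTensor M (f.hom.restrictScalars F)) <| by
      conv_lhs => rw [tensorRel]
      rw [Submodule.span_le]
      rintro _ ⟨c, m, n, rfl⟩
      refine Submodule.subset_span ⟨c, m, f.hom n, ?_⟩
      rw [map_sub, LinearMap.lTensor_tmul, LinearMap.lTensor_tmul, LinearMap.restrictScalars_apply,
        LinearMap.restrictScalars_apply, map_smul]
  map_id N := by
    ext : 1
    refine Submodule.linearMap_qext _ (TensorProduct.ext' fun m n => rfl)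
  map_comp f g := by
    ext : 1
    refine Submodule.linearMap_qext _ (TensorProduct.ext' fun m n => rfl)

open ModuleCat in
instance (M : ModuleCat.{u} S.Env) : (S.tensorFunctor M).Additive where
  map_add {N N' f g} := by
    ext : 1
    refine Submodule.linearMap_qext _ (TensorProduct.ext' fun m n => ?_)
    exact congrArg (S.tensorRel M N').mkQ (TensorProduct.tmul_add m (f.hom n) (g.hom n))

/-- `Hom_{A^e}(N, A^e)`, for the outer bimodule structure of `A^e`.  It is an `A`-bimodule through the
inner structure `a (u ⊗ v^op) b = (u b) ⊗ (a v)^op` of `A^e`, see `dual_smul_apply`. -/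
def Dual (N : ModuleCat.{u} S.Env) : Type u := N →ₗ[S.Env] S.Env

instance (N : ModuleCat.{u} S.Env) : AddCommGroup (S.Dual N) :=
  inferInstanceAs (AddCommGroup (N →ₗ[S.Env] S.Env))

instance (N : ModuleCat.{u} S.Env) : Module S.Envᵐᵒᵖ (S.Dual N) :=
  inferInstanceAs (Module S.Envᵐᵒᵖ (N →ₗ[S.Env] S.Env))

instance (N : ModuleCat.{u} S.Env) : Module S.Env (S.Dual N) :=
  Module.compHom (S.Dual N) S.envSwap.toRingHom

theorem dual_smul_apply (N : ModuleCat.{u} S.Env) (a b : S.Alg) (f : S.Dual N) (n : N) :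
    (show N →ₗ[S.Env] S.Env from S.envMk a b • f) n =
      (show N →ₗ[S.Env] S.Env from f) n * S.envMk b a := rfl

/-- The functor `Hom_{A^e}(-, A^e)` from `A`-bimodules to `A`-bimodules. -/
def dualFunctor : (ModuleCat.{u} S.Env)ᵒᵖ ⥤ ModuleCat.{u} S.Env where
  obj N := ModuleCat.of S.Env (S.Dual N.unop)
  map {N _} f := ModuleCat.ofHom
    { toFun := fun g => LinearMap.comp (show N.unop →ₗ[S.Env] S.Env from g) f.unop.hom
      map_add' := fun _ _ => rfl
      map_smul' := fun _ _ => rfl }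
  map_id _ := rfl
  map_comp _ _ := rfl

instance : S.dualFunctor.Additive where
  map_add {N N' f g} := by
    ext h
    refine LinearMap.ext fun n => ?_
    exact map_add (show N.unop →ₗ[S.Env] S.Env from h) _ _

variable [∀ a b : Q, Fintype (a ⟶ b)]

/-- The value of the Koszul differential on `1 ⊗ w ⊗ 1`.  With `w = x_1 ... x_{p+1}`, it is
`x_1 ⊗ x_2 ... x_{p+1} ⊗ 1 + (-1)^(p+1) 1 ⊗ x_1 ... x_p ⊗ x_{p+1}`; the elements
`∑ x_1 ⊗ x_2 ... x_{p+1}` of `V ⊗_k W_p` and `∑ x_1 ... x_p ⊗ x_{p+1}` of `W_p ⊗_k V` are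
`∑_α α ⊗ lcut α w` and `∑_α rcut α w ⊗ α`, see `sum_arrow_mul_lcut` and `sum_rcut_mul_arrow`. -/
def dGen (p : ℕ) : S.W (p + 1) →ₗ[F] S.KoszulModule p :=
  ∑ α : Arrow Q, (S.tens p (S.env (arrow F α) 1)).comp (S.lcutW α p) +
    (-1 : F) ^ (p + 1) • ∑ α : Arrow Q, (S.tens p (S.env 1 (arrow F α))).comp (S.rcutW α p)

theorem dGen_apply (p : ℕ) (w : S.W (p + 1)) : S.dGen p w =
    ∑ α : Arrow Q, S.tens p (S.env (arrow F α) 1) (S.lcutW α p w) +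
    (-1 : F) ^ (p + 1) • ∑ α : Arrow Q, S.tens p (S.env 1 (arrow F α)) (S.rcutW α p w) := by
  simp [dGen]

/-- The `A^e`-linear extension of `dGen` to `A^e ⊗_F W_{p+1}`. -/
def dExt (p : ℕ) : S.Env ⊗[F] S.W (p + 1) →ₗ[S.Env] S.KoszulModule p :=
  TensorProduct.AlgebraTensorModule.lift (LinearMap.toSpanSingleton S.Env _ (S.dGen p))

theorem dExt_tmul (p : ℕ) (c : S.Env) (w : S.W (p + 1)) :
    S.dExt p (c ⊗ₜ w) = c • S.dGen p w := rfl



theorem dGen_balanced (p : ℕ) (v v' : Q) (w : S.W (p + 1)) :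
    S.env (vertex F v) (vertex F v') • S.dGen p w = S.dGen p (S.vertexW v v' (p + 1) w) := by
  have hw := W_le _ w.2
  rw [dGen_apply, dGen_apply, smul_add,
    smul_comm (S.env (vertex F v) (vertex F v')) ((-1 : F) ^ (p + 1)), Finset.smul_sum,
    Finset.smul_sum (r := S.env (vertex F v) (vertex F v'))]
  refine congrArg₂ _ ?_ (congrArg _ ?_)
  · refine Finset.sum_congr rfl fun α _ => ?_
    rw [smul_tens, env_mul, one_mul, vertex_mul_arrow]
    by_cases h : v = α.2.1
    · have h1 : S.env (arrow F α) (vertex F v') =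
          S.env (arrow F α) 1 * S.env (vertex F α.1) (vertex F v') := by
        rw [env_mul, arrow_mul_vertex, if_pos rfl, mul_one]
      rw [if_pos h, h1, tens_mul_balanced]
      congr 1
      apply Subtype.ext
      change vertex F α.1 * lcut F α w * vertex F v' = lcut F α (vertex F v * w * vertex F v')
      rw [lcut_mul F α (PathAlgebra.vertex_mul_mem F v hw), lcut_vertex_mul F α v hw, if_pos h,
        vertex_mul_lcut F α hw]
    · have h1 : S.lcutW α p (S.vertexW v v' (p + 1) w) = 0 := by
        apply Subtype.ext
        change lcut F α (vertex F v * w * vertex F v') = 0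
        rw [lcut_mul F α (PathAlgebra.vertex_mul_mem F v hw), lcut_vertex_mul F α v hw, if_neg h,
          zero_mul]
      rw [if_neg h, env_zero_left, tens_zero_left, h1, map_zero]
  · refine Finset.sum_congr rfl fun α _ => ?_
    rw [smul_tens, env_mul, mul_one, arrow_mul_vertex]
    by_cases h : α.1 = v'
    · have h1 : S.env (vertex F v) (arrow F α) =
          S.env 1 (arrow F α) * S.env (vertex F v) (vertex F α.2.1) := by
        rw [env_mul, vertex_mul_arrow, if_pos rfl, one_mul]
      rw [if_pos h, h1, tens_mul_balanced]
      congr 1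
      apply Subtype.ext
      change vertex F v * rcut F α w * vertex F α.2.1 = rcut F α (vertex F v * w * vertex F v')
      rw [mul_assoc, rcut_mul_vertex_self F α hw, mul_assoc,
        rcut_mul F α (PathAlgebra.mul_vertex_mem F v' hw), rcut_mul_vertex F α v' hw, if_pos h]
    · have h1 : S.rcutW α p (S.vertexW v v' (p + 1) w) = 0 := by
        apply Subtype.ext
        change rcut F α (vertex F v * w * vertex F v') = 0
        rw [mul_assoc, rcut_mul F α (PathAlgebra.mul_vertex_mem F v' hw),
          rcut_mul_vertex F α v' hw, if_neg h, mul_zero]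
      rw [if_neg h, env_zero_right, tens_zero_left, h1, map_zero]

/-- The Koszul differential `A ⊗_k W_{p+1} ⊗_k A → A ⊗_k W_p ⊗_k A`. -/
def d (p : ℕ) : S.KoszulModule (p + 1) →ₗ[S.Env] S.KoszulModule p :=
  (S.balanced (p + 1)).liftQ (S.dExt p) <| by
    rw [balanced, Submodule.span_le]
    rintro _ ⟨v, v', w, rfl⟩
    rw [SetLike.mem_coe, LinearMap.mem_ker, map_sub, dExt_tmul, dExt_tmul, dGen_balanced, one_smul,
      sub_self]

theorem d_tens (p : ℕ) (c : S.Env) (w : S.W (p + 1)) :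
    S.d p (S.tens (p + 1) c w) = c • S.dGen p w := rfl

/-- The part of `d ∘ d` that only involves left multiplications, in `A ⊗ F Q`. -/
theorem lcut_lcut (r y : PathAlgebra F Q) (hr : r ∈ pathsOfLength F 2) :
    ∑ α : Arrow Q, ∑ β : Arrow Q,
      S.proj (arrow F α * arrow F β) ⊗ₜ[F] (lcut F β (lcut F α r) * y) =
    ∑ v : Q, S.proj (r * vertex F v) ⊗ₜ[F] (vertex F v * y) := by
  refine induction_length F (P := fun r => ∑ α : Arrow Q, ∑ β : Arrow Q,
      S.proj (arrow F α * arrow F β) ⊗ₜ[F] (lcut F β (lcut F α r) * y) =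
      ∑ v : Q, S.proj (r * vertex F v) ⊗ₜ[F] (vertex F v * y)) hr
    (fun a b p hp => ?_) (by simp) (fun x y h h' => ?_) (fun c x h => ?_)
  · cases p with
    | nil => simp at hp
    | @cons c _ p e =>
    cases p with
    | nil => simp at hp
    | cons p f =>
    cases p with
    | cons p g => simp at hp
    | nil =>
    rw [Finset.sum_eq_single ⟨c, b, e⟩, Finset.sum_eq_single ⟨a, c, f⟩, Finset.sum_eq_single a]
    · rw [lcut_cons_self F ⟨c, b, e⟩, lcut_cons_self F ⟨a, c, f⟩, arrow, arrow, ofPath_mul_ofPath,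
        ofPath_mul_vertex, if_pos rfl]
      rfl
    · intro v _ hv
      rw [ofPath_mul_vertex, if_neg hv.symm, map_zero, TensorProduct.zero_tmul]
    · simp
    · intro β _ hβ
      rw [lcut_cons_self F ⟨c, b, e⟩, lcut_cons_ne F β ⟨a, c, f⟩ hβ, zero_mul,
        TensorProduct.tmul_zero]
    · simp
    · intro α _ hα
      refine Finset.sum_eq_zero fun β _ => ?_
      rw [lcut_cons_ne F α ⟨c, b, e⟩ hα, map_zero, zero_mul, TensorProduct.tmul_zero]
    · simp
  · simp only [map_add, add_mul, TensorProduct.tmul_add, TensorProduct.add_tmul,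
      Finset.sum_add_distrib, h, h']
  · simp only [map_smul, smul_mul_assoc, TensorProduct.tmul_smul, ← TensorProduct.smul_tmul',
      ← Finset.smul_sum, h]

/-- The part of `d ∘ d` that only involves right multiplications, in `A ⊗ F Q`. -/
theorem rcut_rcut (r y : PathAlgebra F Q) (hr : r ∈ pathsOfLength F 2) :
    ∑ α : Arrow Q, ∑ β : Arrow Q,
      S.proj (arrow F β * arrow F α) ⊗ₜ[F] (y * rcut F β (rcut F α r)) =
    ∑ v : Q, S.proj (vertex F v * r) ⊗ₜ[F] (y * vertex F v) := by
  refine induction_length F (P := fun r => ∑ α : Arrow Q, ∑ β : Arrow Q,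
      S.proj (arrow F β * arrow F α) ⊗ₜ[F] (y * rcut F β (rcut F α r)) =
      ∑ v : Q, S.proj (vertex F v * r) ⊗ₜ[F] (y * vertex F v)) hr
    (fun a b p hp => ?_) (by simp) (fun x y h h' => ?_) (fun c x h => ?_)
  · cases p with
    | nil => simp at hp
    | @cons c _ p e =>
    cases p with
    | nil => simp at hp
    | cons p f =>
    cases p with
    | cons p g => simp at hp
    | nil =>
    have h1 : ofPath F ((Quiver.Path.nil.cons f).cons e) =
        ofPath F (f.toPath.comp (e.toPath.comp Quiver.Path.nil)) := rfl
    rw [h1]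
    rw [Finset.sum_eq_single ⟨a, c, f⟩, Finset.sum_eq_single ⟨c, b, e⟩, Finset.sum_eq_single b]
    · rw [rcut_comp_self F ⟨a, c, f⟩, rcut_comp_self F ⟨c, b, e⟩, arrow, arrow, ofPath_mul_ofPath,
        vertex_mul_ofPath, if_pos rfl]
      rfl
    · intro v _ hv
      rw [vertex_mul_ofPath, if_neg hv, map_zero, TensorProduct.zero_tmul]
    · simp
    · intro β _ hβ
      rw [rcut_comp_self F ⟨a, c, f⟩, rcut_comp_ne F β ⟨c, b, e⟩ hβ, mul_zero,
        TensorProduct.tmul_zero]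
    · simp
    · intro α _ hα
      refine Finset.sum_eq_zero fun β _ => ?_
      rw [rcut_comp_ne F α ⟨a, c, f⟩ hα, map_zero, mul_zero, TensorProduct.tmul_zero]
    · simp
  · simp only [map_add, mul_add, TensorProduct.tmul_add, TensorProduct.add_tmul,
      Finset.sum_add_distrib, h, h']
  · simp only [map_smul, mul_smul_comm, TensorProduct.tmul_smul, ← TensorProduct.smul_tmul',
      ← Finset.smul_sum, h]

theorem left_part_eq_zero (p : ℕ) (w : S.W (p + 2)) :
    ∑ α : Arrow Q, ∑ β : Arrow Q,
      S.proj (arrow F α * arrow F β) ⊗ₜ[F] (S.lcutW β p (S.lcutW α (p + 1) w)) = 0 := by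
  have inj := Module.Flat.lTensor_preserves_injective_linearMap (M := S.Alg) (S.W p).subtype
    Subtype.val_injective
  apply inj
  simp only [map_sum, LinearMap.lTensor_tmul, map_zero]
  let f : PathAlgebra F Q →ₗ[F] S.Alg ⊗[F] PathAlgebra F Q :=
    ∑ α : Arrow Q, ∑ β : Arrow Q,
      (TensorProduct.mk F S.Alg (PathAlgebra F Q) (S.proj (arrow F α * arrow F β))).comp
        ((lcut F β).comp (lcut F α))
  have hf : ∀ x, f x = ∑ α : Arrow Q, ∑ β : Arrow Q,
      S.proj (arrow F α * arrow F β) ⊗ₜ[F] (lcut F β (lcut F α x)) := fun x => by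
    simp [f]
  refine (hf w).symm.trans ?_
  have hw := (mem_W.1 w.2).2 0 p (by omega)
  suffices h : pathsOfLength F 0 * S.R * pathsOfLength F p ≤ LinearMap.ker f from h hw
  have hR : pathsOfLength F 0 * S.R ≤ S.R := by
    rw [Submodule.mul_le]
    intro x hx r hr
    refine induction_length F (P := fun x => x * r ∈ S.R) hx (fun a b q hq => ?_) (by simp)
      (fun x y h h' => ?_) (fun c x h => ?_)
    · cases q with
      | nil => exact S.vertex_mul_mem _ r hr
      | cons q e => simp at hq
    · rw [add_mul]; exact add_mem h h'
    · rw [smul_mul_assoc]; exact Submodule.smul_mem _ _ h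
  refine (mul_le_mul' hR le_rfl).trans ?_
  rw [Submodule.mul_le]
  intro r hr y _
  rw [LinearMap.mem_ker, hf]
  have hr2 := S.le_two hr
  have h1 : ∀ α β : Arrow Q, lcut F β (lcut F α (r * y)) = lcut F β (lcut F α r) * y :=
    fun α β => by rw [lcut_mul F α hr2, lcut_mul F β (PathAlgebra.lcut_mem F α hr2)]
  simp only [h1]
  rw [lcut_lcut S r y hr2]
  refine Finset.sum_eq_zero fun v _ => ?_
  rw [proj_eq_zero S (S.mul_vertex_mem v r hr), TensorProduct.zero_tmul]

theorem right_part_eq_zero (p : ℕ) (w : S.W (p + 2)) :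
    ∑ α : Arrow Q, ∑ β : Arrow Q,
      S.proj (arrow F β * arrow F α) ⊗ₜ[F] (S.rcutW β p (S.rcutW α (p + 1) w)) = 0 := by
  have inj := Module.Flat.lTensor_preserves_injective_linearMap (M := S.Alg) (S.W p).subtype
    Subtype.val_injective
  apply inj
  simp only [map_sum, LinearMap.lTensor_tmul, map_zero]
  let f : PathAlgebra F Q →ₗ[F] S.Alg ⊗[F] PathAlgebra F Q :=
    ∑ α : Arrow Q, ∑ β : Arrow Q,
      (TensorProduct.mk F S.Alg (PathAlgebra F Q) (S.proj (arrow F β * arrow F α))).comp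
        ((rcut F β).comp (rcut F α))
  have hf : ∀ x, f x = ∑ α : Arrow Q, ∑ β : Arrow Q,
      S.proj (arrow F β * arrow F α) ⊗ₜ[F] (rcut F β (rcut F α x)) := fun x => by
    simp [f]
  refine (hf w).symm.trans ?_
  have hw := (mem_W.1 w.2).2 p 0 (by omega)
  rw [mul_assoc] at hw
  suffices h : pathsOfLength F p * (S.R * pathsOfLength F 0) ≤ LinearMap.ker f from h hw
  have hR : S.R * pathsOfLength F 0 ≤ S.R := by
    rw [Submodule.mul_le]
    intro r hr x hx
    refine induction_length F (P := fun x => r * x ∈ S.R) hx (fun a b q hq => ?_) (by simp)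
      (fun x y h h' => ?_) (fun c x h => ?_)
    · cases q with
      | nil => exact S.mul_vertex_mem _ r hr
      | cons q e => simp at hq
    · rw [mul_add]; exact add_mem h h'
    · rw [mul_smul_comm]; exact Submodule.smul_mem _ _ h
  refine (mul_le_mul' le_rfl hR).trans ?_
  rw [Submodule.mul_le]
  intro y _ r hr
  rw [LinearMap.mem_ker, hf]
  have hr2 := S.le_two hr
  have h1 : ∀ α β : Arrow Q, rcut F β (rcut F α (y * r)) = y * rcut F β (rcut F α r) :=
    fun α β => by rw [rcut_mul F α hr2, rcut_mul F β (PathAlgebra.rcut_mem F α hr2)]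
  simp only [h1]
  rw [rcut_rcut S r y hr2]
  refine Finset.sum_eq_zero fun v _ => ?_
  rw [proj_eq_zero S (S.vertex_mul_mem v r hr), TensorProduct.zero_tmul]

/-- `tens` as a bilinear map. -/
def tensLin (p : ℕ) : S.Env →ₗ[F] S.W p →ₗ[F] S.KoszulModule p :=
  (TensorProduct.mk F S.Env (S.W p)).compr₂ ((S.balanced p).mkQ.restrictScalars F)

/-- `a ↦ a ⊗ 1`. -/
def envLeft : S.Alg →ₗ[F] S.Env :=
  (Algebra.TensorProduct.includeLeft : S.Alg →ₐ[F] S.Alg ⊗[F] S.Algᵐᵒᵖ).toLinearMap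

/-- `b ↦ 1 ⊗ b^op`. -/
def envRight : S.Alg →ₗ[F] S.Env :=
  (Algebra.TensorProduct.includeRight : S.Algᵐᵒᵖ →ₐ[F] S.Alg ⊗[F] S.Algᵐᵒᵖ).toLinearMap.comp
    (opLinearEquiv F).toLinearMap

theorem sum_left_eq_zero (p : ℕ) (w : S.W (p + 2)) :
    ∑ α : Arrow Q, ∑ β : Arrow Q,
      S.tens p (S.env (arrow F α * arrow F β) 1) (S.lcutW β p (S.lcutW α (p + 1) w)) = 0 := by
  have h := congrArg (TensorProduct.lift ((S.tensLin p).comp S.envLeft)) (S.left_part_eq_zero p w)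
  simp only [map_sum, TensorProduct.lift.tmul, map_zero] at h
  exact h

theorem sum_right_eq_zero (p : ℕ) (w : S.W (p + 2)) :
    ∑ α : Arrow Q, ∑ β : Arrow Q,
      S.tens p (S.env 1 (arrow F β * arrow F α)) (S.rcutW β p (S.rcutW α (p + 1) w)) = 0 := by
  have h := congrArg (TensorProduct.lift ((S.tensLin p).comp S.envRight))
    (S.right_part_eq_zero p w)
  simp only [map_sum, TensorProduct.lift.tmul, map_zero] at h
  exact h

theorem d_dGen (p : ℕ) (w : S.W (p + 2)) : S.d p (S.dGen (p + 1) w) = 0 := by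
  have hcomm : ∀ α β : Arrow Q, S.lcutW β p (S.rcutW α (p + 1) w) =
      S.rcutW α p (S.lcutW β (p + 1) w) := fun α β =>
    Subtype.ext (lcut_rcut F β α (W_le _ w.2))
  have hsmul : ∀ (c : F) (z : S.KoszulModule (p + 1)), S.d p (c • z) = c • S.d p z :=
    fun c z => (S.d p).map_smul_of_tower c z
  rw [dGen_apply, map_add, hsmul, map_sum, map_sum]
  simp only [d_tens, dGen_apply, smul_add, Finset.smul_sum, Finset.sum_add_distrib,
    smul_comm (S.env _ _) ((-1 : F) ^ _), smul_tens, env_mul, one_mul, mul_one, hcomm]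
  simp only [← Finset.smul_sum]
  rw [sum_left_eq_zero, sum_right_eq_zero, zero_add, smul_zero, smul_zero, add_zero, pow_succ _ (p + 1),
    mul_neg_one, neg_smul, add_neg_eq_zero]
  refine congrArg _ Finset.sum_comm

theorem d_comp_d (p : ℕ) : (S.d p).comp (S.d (p + 1)) = 0 := by
  refine Submodule.linearMap_qext _ (TensorProduct.AlgebraTensorModule.ext fun c w => ?_)
  change S.d p (S.d (p + 1) (S.tens (p + 2) c w)) = 0
  rw [d_tens, map_smul, d_dGen, smul_zero]


/-- The bimodule Koszul complex `K(A)`, with `A ⊗_k W_p ⊗_k A` in homological degree `p`. -/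
def koszulComplex : ChainComplex (ModuleCat.{u} S.Env) ℕ :=
  ChainComplex.of (fun p => ModuleCat.of S.Env (S.KoszulModule p))
    (fun p => ModuleCat.ofHom (S.d p))
    fun p => by
      rw [← ModuleCat.ofHom_comp, d_comp_d]
      rfl

/-- `K(A)` as a cochain complex: `A ⊗_k W_p ⊗_k A` sits in cohomological degree `-p`. -/
def K : CochainComplex (ModuleCat.{u} S.Env) ℤ :=
  S.koszulComplex.extend ComplexShape.embeddingDownNat

/-- Koszul cohomology `HK^p(A, M) = H^p(Hom_{A^e}(K(A), M))`. -/
def koszulCohomology (M : ModuleCat.{u} S.Env) (p : ℤ) : ModuleCat.{u} F :=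
  (contravariantComplex ((linearYoneda F (ModuleCat.{u} S.Env)).obj M) S.K).homology p

/-- Koszul homology `HK_q(A, M) = H_q(M ⊗_{A^e} K(A))`; homological degree `q` is cohomological
degree `-q`. -/
def koszulHomology (M : ModuleCat.{u} S.Env) (q : ℤ) : ModuleCat.{u} F :=
  (((S.tensorFunctor M).mapHomologicalComplex (ComplexShape.up ℤ)).obj S.K).homology (-q)

/-- `Y` is `RHom_{A^e}(X, A^e)` in the derived category of `A`-bimodules: it is represented by the
complex of bimodules `Hom_{A^e}(P, A^e)` for a K-projective resolution `P → X`.  (The choice of the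
resolution does not matter up to isomorphism.) -/
def IsRHomEnv [HasDerivedCategory.{u + 1} (ModuleCat.{u} S.Env)]
    (X : CochainComplex (ModuleCat.{u} S.Env) ℤ)
    (Y : DerivedCategory (ModuleCat.{u} S.Env)) : Prop :=
  ∃ (P : CochainComplex (ModuleCat.{u} S.Env) ℤ) (f : P ⟶ X),
    P.IsKProjective ∧ QuasiIso f ∧
      Nonempty (DerivedCategory.Q.obj (contravariantComplex S.dualFunctor P) ≅ Y)

/-- `K(A)` has length `n`: its largest nonzero degree is `n`. -/
def KoszulLength (n : ℕ) : Prop :=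
  Nontrivial (S.KoszulModule n) ∧ ∀ p, n < p → Subsingleton (S.KoszulModule p)

/-- `A` is Koszul complex Calabi-Yau of dimension `n`: `K(A)` has length `n`, and
`RHom_{A^e}(K(A), A^e) ≅ K(A)[-n]` in the derived category of `A`-bimodules.  (Both sides are bounded,
and the bounded derived category is a full subcategory of the derived category.) -/
def IsKoszulComplexCalabiYau (n : ℕ) : Prop :=
  S.KoszulLength n ∧
    letI : HasDerivedCategory.{u + 1} (ModuleCat.{u} S.Env) := HasDerivedCategory.standard _
    S.IsRHomEnv S.K ((DerivedCategory.Q.obj S.K)⟦(-n : ℤ)⟧)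

end QuadraticRelations

end

/-!
The complex `K(A)` is a bounded complex of finitely generated projective `A`-bimodules: the paths of
a given length are finite in number, so `W_p` is finite-dimensional, and since `k` is separable the
quotient map from the free module `A ⊗_F W_p ⊗_F A` to `A ⊗_k W_p ⊗_k A` splits. Two facts follow.

* `K(A)` is K-projective, so `RHom(K(A), A^e)` may be computed with `K(A)` itself. The dual
  `Hom(K(A), A^e)` is again a bounded complex of projectives, so it is K-projective as well, and the
  Calabi-Yau isomorphism in the derived category comes from a homotopy equivalence
  `Hom(K(A), A^e) ≃ K(A)[-n]` (`IsKoszulComplexCalabiYau.nonempty_homotopyEquiv`).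
* For every bimodule `M`, evaluation `m ⊗ f ↦ (x ↦ f(x) m)` is a natural isomorphism
  `M ⊗_{A^e} Hom(N, A^e) ≅ Hom(N, M)` for `N` finitely generated projective (`evalIso`), with
  inverse given by a dual basis. Hence `M ⊗_{A^e} Hom(K(A), A^e) ≅ Hom(K(A), M)`.

The functor `M ⊗_{A^e} -` preserves homotopy equivalences, so `Hom(K(A), M)` and
`M ⊗_{A^e} K(A)[-n]` have the same cohomology; in degree `p` these are `HK^p(A, M)` and
`HK_{n-p}(A, M)`.
-/

noncomputable section

/-! ### Contravariant functors applied to cochain complexes -/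

namespace ContravariantComplex

variable {C : Type*} [Category* C] [Preadditive C] {D : Type*} [Category* D] [Preadditive D]
  (G : Cᵒᵖ ⥤ D) [G.Additive] {X Y Z : CochainComplex C ℤ}

/-- The morphism of complexes induced by a morphism in the other direction. -/
def map (φ : X ⟶ Y) : contravariantComplex G Y ⟶ contravariantComplex G X where
  f i := G.map (φ.f (-i)).op
  comm' i j _ := by
    dsimp only [contravariantComplex]
    rw [Linear.comp_units_smul, Linear.units_smul_comp, ← G.map_comp, ← G.map_comp, ← op_comp,
      ← op_comp, φ.comm]

theorem map_id : map G (𝟙 X) = 𝟙 (contravariantComplex G X) := by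
  ext i
  exact G.map_id _

theorem map_comp (φ : X ⟶ Y) (ψ : Y ⟶ Z) : map G (φ ≫ ψ) = map G ψ ≫ map G φ := by
  ext i
  exact G.map_comp _ _

/-- The components of the homotopy induced by a homotopy on the contravariant complexes. The sign
compensates the one in the differential of `contravariantComplex`. -/
def homotopyHom {φ ψ : X ⟶ Y} (h : Homotopy φ ψ) (i j : ℤ) :
    (contravariantComplex G Y).X i ⟶ (contravariantComplex G X).X j :=
  i.negOnePow • G.map (h.hom (-j) (-i)).op

/-- Homotopic morphisms induce homotopic morphisms on the contravariant complexes. -/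
def mapHomotopy {φ ψ : X ⟶ Y} (h : Homotopy φ ψ) : Homotopy (map G φ) (map G ψ) where
  hom := homotopyHom G h
  zero i j hij := by
    have h0 : ¬ (ComplexShape.up ℤ).Rel (-i) (-j) := by
      simp only [ComplexShape.up_Rel] at hij ⊢
      omega
    rw [homotopyHom, h.zero _ _ h0, Limits.op_zero, G.map_zero]
    exact smul_zero (A := G.obj (.op (Y.X (-i))) ⟶ G.obj (.op (X.X (-j)))) _
  comm i := by
    have hd := h.comm (-i)
    rw [dNext_eq h.hom (show (ComplexShape.up ℤ).Rel (-i) (-(i - 1)) by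
        simp only [ComplexShape.up_Rel]; omega),
      prevD_eq h.hom (show (ComplexShape.up ℤ).Rel (-(i + 1)) (-i) by simp)] at hd
    rw [dNext_eq _ (show (ComplexShape.up ℤ).Rel i (i + 1) by simp),
      prevD_eq _ (show (ComplexShape.up ℤ).Rel (i - 1) i by simp)]
    change G.map (φ.f (-i)).op =
      ((i + 1).negOnePow • G.map (Y.d (-(i + 1)) (-i)).op) ≫
          ((i + 1).negOnePow • G.map (h.hom (-i) (-(i + 1))).op) +
        (i.negOnePow • G.map (h.hom (-(i - 1)) (-i)).op) ≫
          ((i - 1 + 1).negOnePow • G.map (X.d (-i) (-(i - 1))).op) + G.map (ψ.f (-i)).op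
    rw [hd, sub_add_cancel]
    simp only [Linear.comp_units_smul, Linear.units_smul_comp, smul_smul, Int.units_mul_self,
      one_smul, CategoryTheory.op_add, op_comp, G.map_add, G.map_comp]
    abel

/-- A homotopy equivalence induces a homotopy equivalence of contravariant complexes. -/
def mapHomotopyEquiv (e : HomotopyEquiv X Y) :
    HomotopyEquiv (contravariantComplex G Y) (contravariantComplex G X) where
  hom := map G e.hom
  inv := map G e.inv
  homotopyHomInvId := (Homotopy.ofEq (map_comp G _ _).symm).trans
    ((mapHomotopy G e.homotopyInvHomId).trans (Homotopy.ofEq (map_id G)))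
  homotopyInvHomId := (Homotopy.ofEq (map_comp G _ _).symm).trans
    ((mapHomotopy G e.homotopyHomInvId).trans (Homotopy.ofEq (map_id G)))

/-- Let `H` be covariant. Isomorphisms `H (G N) ≅ G' N` that are natural with respect to the
differentials of `X` assemble to an isomorphism of complexes. -/
def mapIso {E : Type*} [Category* E] [Preadditive E] (H : D ⥤ E) [H.Additive] (G' : Cᵒᵖ ⥤ E)
    [G'.Additive] (X : CochainComplex C ℤ)
    (e : ∀ i, H.obj (G.obj (.op (X.X i))) ≅ G'.obj (.op (X.X i)))
    (he : ∀ i j, H.map (G.map (X.d i j).op) ≫ (e i).hom = (e j).hom ≫ G'.map (X.d i j).op) :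
    (H.mapHomologicalComplex (ComplexShape.up ℤ)).obj (contravariantComplex G X) ≅
      contravariantComplex G' X :=
  HomologicalComplex.Hom.isoOfComponents (fun i => e (-i)) fun i j _ => by
    change (e (-i)).hom ≫ ((i + 1).negOnePow • G'.map (X.d (-j) (-i)).op) =
      H.map ((i + 1).negOnePow • G.map (X.d (-j) (-i)).op) ≫ (e (-j)).hom
    rw [Functor.map_units_smul, Linear.units_smul_comp, Linear.comp_units_smul, he]

end ContravariantComplex

/-! ### Homotopy equivalences from the derived category -/

/-- Isomorphic objects of the derived category that are represented by K-projective complexes are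
homotopy equivalent. -/
theorem CochainComplex.IsKProjective.nonempty_homotopyEquiv {C : Type*} [Category* C] [Abelian C]
    [HasDerivedCategory C] {X Y : CochainComplex C ℤ} [X.IsKProjective] [Y.IsKProjective]
    (e : DerivedCategory.Q.obj X ≅ DerivedCategory.Q.obj Y) : Nonempty (HomotopyEquiv X Y) := by
  let e' := (DerivedCategory.quotientCompQhIso C).app X ≪≫ e ≪≫
    ((DerivedCategory.quotientCompQhIso C).app Y).symm
  obtain ⟨f, hf⟩ := (Qh_map_bijective X _).surjective e'.hom
  obtain ⟨g, hg⟩ := (Qh_map_bijective Y _).surjective e'.inv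
  refine ⟨HomotopyCategory.homotopyEquivOfIso ⟨f, g, ?_, ?_⟩⟩
  · apply (Qh_map_bijective X _).injective
    rw [Functor.map_comp, hf, hg, CategoryTheory.Functor.map_id]
    exact e'.hom_inv_id
  · apply (Qh_map_bijective Y _).injective
    rw [Functor.map_comp, hf, hg, CategoryTheory.Functor.map_id]
    exact e'.inv_hom_id

/-- An additive functor `H` takes a homotopy equivalence `X ≃ Y⟦m⟧` to an isomorphism of the
cohomology of `H X` in degree `p` with that of `H Y` in degree `m + p`. -/
theorem HomotopyEquiv.nonempty_homology_iso_of_shift {C : Type*} [Category* C] [Preadditive C]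
    {D : Type*} [Category* D] [Preadditive D] [CategoryWithHomology D] (H : C ⥤ D) [H.Additive]
    {X Y : CochainComplex C ℤ} (m : ℤ) (e : HomotopyEquiv X (Y⟦m⟧)) (p q : ℤ) (hq : m + p = q) :
    Nonempty (((H.mapHomologicalComplex (ComplexShape.up ℤ)).obj X).homology p ≅
      ((H.mapHomologicalComplex (ComplexShape.up ℤ)).obj Y).homology q) :=
  ⟨(H.mapHomotopyEquiv e).toHomologyIso p ≪≫
    (HomologicalComplex.homologyFunctor D _ p).mapIso ((H.mapCochainComplexShiftIso m).app Y) ≪≫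
    (CochainComplex.ShiftSequence.shiftIso D m p q hq).app _⟩

namespace PathAlgebra

/-! ### Finiteness and projectivity of the Koszul bimodules -/

theorem finite_paths_of_length {Q : Type u} [Quiver.{u} Q] [Fintype Q]
    [∀ a b : Q, Fintype (a ⟶ b)] (m : ℕ) (a b : Q) :
    {p : Quiver.Path a b | p.length = m}.Finite := by
  induction m generalizing b with
  | zero =>
    refine Set.Subsingleton.finite fun p hp q hq => ?_
    cases p with
    | nil =>
      cases q with
      | nil => rfl
      | cons q f => simp at hq
    | cons p e => simp at hp
  | succ m ih =>
    have h : (⋃ c : Q, ⋃ e : c ⟶ b,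
        (fun p : Quiver.Path a c => p.cons e) '' {p | p.length = m}).Finite :=
      Set.finite_iUnion fun c => Set.finite_iUnion fun e => (ih c).image _
    refine h.subset fun p hp => ?_
    cases p with
    | nil => simp at hp
    | @cons c _ p e =>
      simp only [Set.mem_iUnion]
      exact ⟨c, e, p, by simpa using hp, rfl⟩

variable (F : Type u) [Field F] {Q : Type u} [Quiver.{u} Q] [Fintype Q] [DecidableEq Q]

instance [∀ a b : Q, Fintype (a ⟶ b)] (m : ℕ) :
    Module.Finite F (pathsOfLength F (Q := Q) m) := by
  refine Module.Finite.span_of_finite F ?_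
  have h : (⋃ a : Q, ⋃ b : Q,
      (fun p : Quiver.Path a b => ofPath F p) '' {p | p.length = m}).Finite :=
    Set.finite_iUnion fun a => Set.finite_iUnion fun b => (finite_paths_of_length m a b).image _
  refine h.subset ?_
  rintro _ ⟨a, b, p, hp, rfl⟩
  simp only [Set.mem_iUnion]
  exact ⟨a, b, p, hp, rfl⟩

theorem vertex_mul_vertex (v w : Q) :
    vertex F v * vertex F w = if v = w then vertex F w else 0 := vertex_mul_ofPath F _ _

theorem sum_vertex : ∑ v : Q, vertex F v = 1 := rfl

end PathAlgebra

namespace QuadraticRelations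

open PathAlgebra

variable {F : Type u} [Field F] {Q : Type u} [Quiver.{u} Q] [Fintype Q] [DecidableEq Q]
  (S : QuadraticRelations F Q)

instance [∀ a b : Q, Fintype (a ⟶ b)] (p : ℕ) : Module.Finite F (S.W p) :=
  Module.Finite.of_injective (Submodule.inclusion (W_le p)) (Submodule.inclusion_injective _)

theorem vertexW_vertexW (u u' v v' : Q) (p : ℕ) (w : S.W p) :
    S.vertexW u u' p (S.vertexW v v' p w) =
      if u = v ∧ u' = v' then S.vertexW v v' p w else 0 := by
  apply Subtype.ext
  change vertex F u * (vertex F v * w * vertex F v') * vertex F u' = _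
  rw [show vertex F u * (vertex F v * (w : PathAlgebra F Q) * vertex F v') * vertex F u' =
    (vertex F u * vertex F v) * w * (vertex F v' * vertex F u') by simp only [mul_assoc],
    vertex_mul_vertex, vertex_mul_vertex]
  by_cases h : u = v
  · by_cases h' : u' = v'
    · subst h h'
      simp only [if_true, and_self]
      rfl
    · simp [h', Ne.symm h']
  · simp [h]

theorem sum_vertexW (p : ℕ) (w : S.W p) : ∑ v : Q, ∑ v' : Q, S.vertexW v v' p w = w := by
  apply Subtype.ext
  simp only [AddSubmonoidClass.coe_finsetSum]
  change ∑ v : Q, ∑ v' : Q, vertex F v * (w : PathAlgebra F Q) * vertex F v' = w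
  simp only [← Finset.mul_sum, ← Finset.sum_mul, sum_vertex, one_mul, mul_one]

/-- The `A^e`-linear map `A^e ⊗_F W_p → A^e ⊗_F W_p` that sends `c ⊗ w` to
`∑ c (e_v ⊗ e_{v'}^op) ⊗ e_v w e_{v'}`. It is the idempotent with kernel `balanced p`. -/
def separate (p : ℕ) : S.Env ⊗[F] S.W p →ₗ[S.Env] S.Env ⊗[F] S.W p :=
  TensorProduct.AlgebraTensorModule.lift (LinearMap.toSpanSingleton S.Env _
    (∑ v : Q, ∑ v' : Q, (TensorProduct.mk F S.Env (S.W p) (S.env (vertex F v) (vertex F v'))).comp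
      (S.vertexW v v' p)))

theorem separate_tmul (p : ℕ) (c : S.Env) (w : S.W p) :
    S.separate p (c ⊗ₜ w) =
      ∑ v : Q, ∑ v' : Q, (c * S.env (vertex F v) (vertex F v')) ⊗ₜ S.vertexW v v' p w := by
  have h : S.separate p (c ⊗ₜ w) = c • (∑ v : Q, ∑ v' : Q,
    (TensorProduct.mk F S.Env (S.W p) (S.env (vertex F v) (vertex F v'))).comp
      (S.vertexW v v' p)) w := rfl
  rw [h]
  simp only [LinearMap.sum_apply, Finset.smul_sum]
  rfl

theorem balanced_le_ker_separate (p : ℕ) : S.balanced p ≤ LinearMap.ker (S.separate p) := by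
  rw [balanced, Submodule.span_le]
  rintro _ ⟨u, u', w, rfl⟩
  rw [SetLike.mem_coe, LinearMap.mem_ker, map_sub, sub_eq_zero, separate_tmul, separate_tmul,
    Finset.sum_eq_single u, Finset.sum_eq_single u', Finset.sum_eq_single u,
    Finset.sum_eq_single u']
  · rw [env_mul, vertex_mul_vertex, vertex_mul_vertex, if_pos rfl, if_pos rfl, one_mul,
      vertexW_vertexW, if_pos ⟨rfl, rfl⟩]
  · intro v' _ h
    rw [vertexW_vertexW, if_neg fun h' => h h'.2, TensorProduct.tmul_zero]
  · simp
  · intro v _ h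
    refine Finset.sum_eq_zero fun v' _ => ?_
    rw [vertexW_vertexW, if_neg fun h' => h h'.1, TensorProduct.tmul_zero]
  · simp
  · intro v' _ h
    rw [env_mul, vertex_mul_vertex, vertex_mul_vertex, if_neg h, env_zero_right,
      TensorProduct.zero_tmul]
  · simp
  · intro v _ h
    refine Finset.sum_eq_zero fun v' _ => ?_
    rw [env_mul, vertex_mul_vertex, if_neg h.symm, env_zero_left, TensorProduct.zero_tmul]
  · simp

/-- The quotient map `A ⊗_F W_p ⊗_F A → A ⊗_k W_p ⊗_k A` splits, because `k` is separable. -/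
instance (p : ℕ) : Module.Projective S.Env (S.KoszulModule p) := by
  refine Module.Projective.of_split
    ((S.balanced p).liftQ (S.separate p) (S.balanced_le_ker_separate p)) (S.balanced p).mkQ ?_
  refine Submodule.linearMap_qext _ (TensorProduct.AlgebraTensorModule.ext fun c w => ?_)
  change (S.balanced p).mkQ (S.separate p (c ⊗ₜ w)) = S.tens p c w
  rw [separate_tmul]
  simp only [map_sum]
  change ∑ v : Q, ∑ v' : Q, S.tens p (c * S.env (vertex F v) (vertex F v')) (S.vertexW v v' p w) = _
  simp only [tens_mul_balanced, vertexW_vertexW, and_self, if_true]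
  simp only [← map_sum, sum_vertexW]

/-! ### Duals of finitely generated projective bimodules -/

theorem unop_envSwap_unop_envSwap (c : S.Env) : (S.envSwap (S.envSwap c).unop).unop = c := by
  refine TensorProduct.induction_on (R := F) (M := S.Alg) (N := S.Algᵐᵒᵖ)
    (motive := fun c : S.Env => (S.envSwap (S.envSwap c).unop).unop = c) c ?_ ?_ ?_
  · exact (congrArg (fun x => (S.envSwap (unop x)).unop) (map_zero S.envSwap)).trans
      (congrArg unop (map_zero S.envSwap))
  · intro a b
    change (S.envSwap (S.envSwap (S.envMk a b.unop)).unop).unop = S.envMk a b.unop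
    rw [envSwap_envMk, unop_op, envSwap_envMk, unop_op]
  · intro x y hx hy
    have h (a b : S.Env) : (S.envSwap (a + b)).unop = (S.envSwap a).unop + (S.envSwap b).unop :=
      congrArg unop (map_add S.envSwap a b)
    exact (congrArg (fun z => (S.envSwap z).unop) (h x y)).trans
      ((h _ _).trans (congrArg₂ (· + ·) hx hy))

/-- Evaluation of an element of the dual. -/
def Dual.eval (N : ModuleCat.{u} S.Env) (f : S.Dual N) : N →ₗ[S.Env] S.Env := f

theorem Dual.eval_smul (N : ModuleCat.{u} S.Env) (c : S.Env) (f : S.Dual N) (x : N) :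
    Dual.eval S N (c • f) x = Dual.eval S N f x * (S.envSwap c).unop := rfl

theorem Dual.eval_sum (N : ModuleCat.{u} S.Env) {ι : Type*} (s : Finset ι) (f : ι → S.Dual N)
    (x : N) : Dual.eval S N (∑ i ∈ s, f i) x = ∑ i ∈ s, Dual.eval S N (f i) x :=
  LinearMap.sum_apply s f x

/-- A finite dual basis of a finitely generated projective module. -/
theorem exists_dualBasis (N : ModuleCat.{u} S.Env) [Module.Finite S.Env N]
    [Module.Projective S.Env N] :
    ∃ (n : ℕ) (x : Fin n → N) (φ : Fin n → (N →ₗ[S.Env] S.Env)), ∀ y, ∑ i, φ i y • x i = y := by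
  obtain ⟨n, f, g, -, -, hfg⟩ := Module.Finite.exists_comp_eq_id_of_projective S.Env N
  refine ⟨n, fun i => f (Pi.single i 1), fun i => (LinearMap.proj i).comp g, fun y => ?_⟩
  conv_rhs => rw [← LinearMap.id_apply (R := S.Env) y, ← hfg, LinearMap.comp_apply,
    ← Finset.univ_sum_single (g y), map_sum]
  refine Finset.sum_congr rfl fun i _ => ?_
  rw [LinearMap.comp_apply, LinearMap.proj_apply, ← map_smul, ← Pi.single_smul, smul_eq_mul,
    mul_one]

/-- The value of `f` at `x`, carried to `A^e` by the anti-automorphism, so that it becomes linear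
in `f`. -/
def Dual.coord (N : ModuleCat.{u} S.Env) (x : N) : S.Dual N →ₗ[S.Env] S.Env where
  toFun f := (S.envSwap (Dual.eval S N f x)).unop
  map_add' f g := by
    change (S.envSwap (Dual.eval S N f x + Dual.eval S N g x)).unop = _
    rw [map_add]
    rfl
  map_smul' c f := by
    rw [Dual.eval_smul, map_mul, unop_mul, unop_envSwap_unop_envSwap]
    rfl

/-- Expansion of an element of the dual in a dual basis. -/
theorem Dual.sum_smul {N : ModuleCat.{u} S.Env} {n : ℕ} {x : Fin n → N}
    {φ : Fin n → (N →ₗ[S.Env] S.Env)} (h : ∀ y, ∑ i, φ i y • x i = y) (f : S.Dual N) :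
    ∑ i, Dual.coord S N (x i) f • (show S.Dual N from φ i) = f := by
  refine LinearMap.ext fun y => ?_
  change Dual.eval S N (∑ i, Dual.coord S N (x i) f • (show S.Dual N from φ i)) y =
    Dual.eval S N f y
  rw [Dual.eval_sum]
  conv_rhs => rw [← h y, map_sum]
  refine Finset.sum_congr rfl fun i _ => ?_
  rw [map_smul, Dual.eval_smul]
  exact congrArg (_ * ·) (unop_envSwap_unop_envSwap S _)

instance (N : ModuleCat.{u} S.Env) [Module.Finite S.Env N] [Module.Projective S.Env N] :
    Module.Projective S.Env (S.Dual N) := by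
  obtain ⟨n, x, φ, h⟩ := S.exists_dualBasis N
  refine Module.Projective.of_split (LinearMap.pi fun i => Dual.coord S N (x i))
    (Fintype.linearCombination S.Env fun i => (show S.Dual N from φ i)) (LinearMap.ext fun f => ?_)
  exact Dual.sum_smul S h f

end QuadraticRelations

namespace QuadraticRelations

open PathAlgebra

variable {F : Type u} [Field F] {Q : Type u} [Quiver.{u} Q] [Fintype Q] [DecidableEq Q]
  (S : QuadraticRelations F Q)

/-! ### The isomorphism `M ⊗ Hom(N, A^e) ≅ Hom(N, M)` -/

open ModuleCat in
/-- The evaluation map `m ⊗ f ↦ (x ↦ f(x) m)`, before passing to the quotient. -/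
def evalTensor (M N : ModuleCat.{u} S.Env) :
    M ⊗[F] (S.dualFunctor.obj (.op N)) →ₗ[F] (N ⟶ M) :=
  TensorProduct.lift <| LinearMap.mk₂ F
    (fun (m : M) (f : S.dualFunctor.obj (.op N)) =>
      ModuleCat.ofHom ((LinearMap.toSpanSingleton S.Env M m).comp (Dual.eval S N f)))
    (fun m m' f => by
      ext x
      exact smul_add (Dual.eval S N f x) m m')
    (fun c m f => by
      ext x
      exact smul_comm (Dual.eval S N f x) c m)
    (fun m f f' => by
      ext x
      exact add_smul (Dual.eval S N f x) (Dual.eval S N f' x) m)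
    (fun c m f => by
      ext x
      change (Dual.eval S N (algebraMap F S.Env c • (show S.Dual N from f)) x) • m =
        algebraMap F S.Env c • Dual.eval S N f x • m
      rw [Dual.eval_smul, AlgHom.commutes, ← mul_smul, Algebra.commutes]
      rfl)

open ModuleCat in
theorem tensorRel_le_ker_evalTensor (M N : ModuleCat.{u} S.Env) :
    S.tensorRel M (S.dualFunctor.obj (.op N)) ≤ LinearMap.ker (S.evalTensor M N) := by
  rw [tensorRel, Submodule.span_le]
  rintro _ ⟨c, m, f, rfl⟩
  rw [SetLike.mem_coe, LinearMap.mem_ker, map_sub, sub_eq_zero]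
  ext x
  change Dual.eval S N f x • (S.envSwap c).unop • m =
    Dual.eval S N (c • (show S.Dual N from f)) x • m
  rw [Dual.eval_smul, mul_smul]

open ModuleCat in
/-- The evaluation map `M ⊗_{A^e} Hom(N, A^e) → Hom(N, M)`. -/
def evalHom (M N : ModuleCat.{u} S.Env) :
    ((S.tensorFunctor M).obj (S.dualFunctor.obj (.op N)) : Type u) →ₗ[F]
      (((linearYoneda F (ModuleCat.{u} S.Env)).obj M).obj (.op N) : Type u) :=
  (S.tensorRel M (S.dualFunctor.obj (.op N))).liftQ (S.evalTensor M N)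
    (S.tensorRel_le_ker_evalTensor M N)

open ModuleCat in
theorem evalHom_bijective (M N : ModuleCat.{u} S.Env) [Module.Finite S.Env N]
    [Module.Projective S.Env N] : Function.Bijective (S.evalHom M N) := by
  obtain ⟨n, x, φ, h⟩ := S.exists_dualBasis N
  let R := S.tensorRel M (S.dualFunctor.obj (.op N))
  let t (m : M) (f : S.Dual N) : (M ⊗[F] (S.dualFunctor.obj (.op N))) := m ⊗ₜ f
  let inv (g : N ⟶ M) : (M ⊗[F] (S.dualFunctor.obj (.op N))) ⧸ R :=
    ∑ i, R.mkQ (t (g.hom (x i)) (φ i))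
  have inv_add (g g' : N ⟶ M) : inv (g + g') = inv g + inv g' := by
    simp only [inv, ← Finset.sum_add_distrib, ← map_add]
    refine Finset.sum_congr rfl fun i _ => congrArg R.mkQ ?_
    exact TensorProduct.add_tmul (g.hom (x i)) (g'.hom (x i)) _
  refine Function.bijective_iff_has_inverse.2 ⟨inv, fun z => ?_, fun g => ?_⟩
  · obtain ⟨z, rfl⟩ := R.mkQ_surjective z
    change inv (S.evalTensor M N z) = R.mkQ z
    induction z with
    | zero =>
      rw [map_zero, map_zero]
      simpa using inv_add 0 0
    | add z z' hz hz' => rw [map_add, inv_add, hz, hz', map_add]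
    | tmul m f =>
      have hR (c : S.Env) (f : S.Dual N) :
          R.mkQ (t (c • m) f) = R.mkQ (t m ((S.envSwap c).unop • f)) := by
        refine (Submodule.Quotient.eq _).2 (Submodule.subset_span ⟨(S.envSwap c).unop, m, f, ?_⟩)
        rw [unop_envSwap_unop_envSwap]
        rfl
      change ∑ i, R.mkQ (t (Dual.eval S N f (x i) • m) (φ i)) = R.mkQ (t m f)
      rw [Finset.sum_congr rfl fun i _ => hR _ (φ i), ← map_sum]
      refine congrArg R.mkQ ((TensorProduct.tmul_sum _ _ _).symm.trans ?_)
      exact congrArg (t m) (Dual.sum_smul S h f)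
  · change S.evalHom M N (∑ i, R.mkQ (t (g.hom (x i)) (φ i))) = g
    refine (map_sum (S.evalHom M N) _ _).trans ?_
    change ∑ i, S.evalTensor M N (t (g.hom (x i)) (φ i)) = g
    ext y
    rw [ModuleCat.hom_sum, LinearMap.sum_apply]
    change ∑ i, φ i y • g.hom (x i) = g.hom y
    conv_rhs => rw [← h y, map_sum]
    simp only [map_smul]

/-- The isomorphism `M ⊗_{A^e} Hom(N, A^e) ≅ Hom(N, M)` for `N` finitely generated projective. -/
def evalIso (M N : ModuleCat.{u} S.Env) [Module.Finite S.Env N] [Module.Projective S.Env N] :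
    (S.tensorFunctor M).obj (S.dualFunctor.obj (.op N)) ≅
      ((linearYoneda F (ModuleCat.{u} S.Env)).obj M).obj (.op N) :=
  (LinearEquiv.ofBijective (S.evalHom M N) (S.evalHom_bijective M N)).toModuleIso

open ModuleCat in
theorem evalIso_naturality (M : ModuleCat.{u} S.Env) {N N' : ModuleCat.{u} S.Env}
    [Module.Finite S.Env N] [Module.Projective S.Env N]
    [Module.Finite S.Env N'] [Module.Projective S.Env N'] (f : N ⟶ N') :
    (S.tensorFunctor M).map (S.dualFunctor.map f.op) ≫ (S.evalIso M N).hom =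
      (S.evalIso M N').hom ≫ ((linearYoneda F (ModuleCat.{u} S.Env)).obj M).map f.op := by
  ext : 1
  refine Submodule.linearMap_qext _ (TensorProduct.ext' fun m n => ?_)
  rfl

/-! ### The Calabi-Yau isomorphism as a homotopy equivalence -/

variable [∀ a b : Q, Fintype (a ⟶ b)]

/-- Each term of `K(A)` is some `A ⊗_k W_p ⊗_k A` or zero. -/
theorem K_X_cases (i : ℤ) : (∃ p : ℕ, i = -p ∧
    Nonempty (S.K.X i ≅ ModuleCat.of S.Env (S.KoszulModule p))) ∨
      Limits.IsZero (S.K.X i) := by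
  by_cases h : ∃ p : ℕ, -(p : ℤ) = i
  · obtain ⟨p, hp⟩ := h
    exact .inl ⟨p, hp.symm, ⟨S.koszulComplex.extendXIso ComplexShape.embeddingDownNat hp⟩⟩
  · exact .inr (S.koszulComplex.isZero_extend_X _ _ fun p hp => h ⟨p, hp⟩)

instance (i : ℤ) : Module.Finite S.Env (S.K.X i) := by
  obtain ⟨p, -, ⟨e⟩⟩ | h := S.K_X_cases i
  · exact Module.Finite.equiv e.toLinearEquiv.symm
  · have := ModuleCat.subsingleton_of_isZero h
    infer_instance

instance projective_K_X (i : ℤ) : Module.Projective S.Env (S.K.X i) := by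
  obtain ⟨p, -, ⟨e⟩⟩ | h := S.K_X_cases i
  · exact Module.Projective.of_equiv e.toLinearEquiv.symm
  · have := ModuleCat.subsingleton_of_isZero h
    infer_instance

instance : S.K.IsKProjective := by
  have (i : ℤ) : Projective (S.K.X i) := 
    (IsProjective.iff_projective (R := S.Env) (S.K.X i)).1 (S.projective_K_X i)
  have : S.K.IsStrictlyLE 0 := inferInstanceAs
    (CochainComplex.IsStrictlyLE (S.koszulComplex.extend ComplexShape.embeddingDownNat) 0)
  exact CochainComplex.isKProjective_of_projective _ 0

/-- If `K(A)` is bounded, its dual is a bounded complex of projectives. -/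
theorem isKProjective_dual {n : ℕ} (hn : S.KoszulLength n) :
    (contravariantComplex S.dualFunctor S.K).IsKProjective := by
  have (i : ℤ) : Projective ((contravariantComplex S.dualFunctor S.K).X i) :=
    (IsProjective.iff_projective (R := S.Env) (S.Dual (S.K.X (-i)))).1 inferInstance
  have : (contravariantComplex S.dualFunctor S.K).IsStrictlyLE n := by
    rw [CochainComplex.isStrictlyLE_iff]
    intro i hi
    have : Subsingleton (S.K.X (-i)) := by
      obtain ⟨p, hp, ⟨e⟩⟩ | h := S.K_X_cases (-i)
      · have := hn.2 p (by omega)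
        exact e.toLinearEquiv.toEquiv.subsingleton
      · exact ModuleCat.subsingleton_of_isZero h
    have : Subsingleton (S.Dual (S.K.X (-i))) :=
      inferInstanceAs (Subsingleton (S.K.X (-i) →ₗ[S.Env] S.Env))
    exact ModuleCat.isZero_of_subsingleton (ModuleCat.of S.Env (S.Dual (S.K.X (-i))))
  exact CochainComplex.isKProjective_of_projective _ n

/-- For a Koszul complex Calabi-Yau algebra, the isomorphism `RHom(K(A), A^e) ≅ K(A)[-n]` is
realized by a homotopy equivalence. -/
theorem IsKoszulComplexCalabiYau.nonempty_homotopyEquiv {n : ℕ}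
    (hA : S.IsKoszulComplexCalabiYau n) :
    Nonempty (HomotopyEquiv (contravariantComplex S.dualFunctor S.K) (S.K⟦(-n : ℤ)⟧)) := by
  let _ : HasDerivedCategory.{u + 1} (ModuleCat.{u} S.Env) := HasDerivedCategory.standard _
  obtain ⟨hn, P, f, hP, hf, ⟨e⟩⟩ := hA
  have := S.isKProjective_dual hn
  obtain ⟨g, -⟩ := (CochainComplex.IsKProjective.quasiIso_iff f).1 hf
  let g' := ContravariantComplex.mapHomotopyEquiv S.dualFunctor g
  have : QuasiIso g'.hom := g'.quasiIso_hom
  exact CochainComplex.IsKProjective.nonempty_homotopyEquiv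
    (asIso (DerivedCategory.Q.map g'.hom) ≪≫ e ≪≫
      ((DerivedCategory.Q.commShiftIso (-n : ℤ)).app S.K).symm)

end QuadraticRelations

end

theorem mainTheorem4 {F : Type u} [Field F] {Q : Type u} [Quiver.{u} Q] [Fintype Q]
    [DecidableEq Q] [∀ a b : Q, Fintype (a ⟶ b)] (S : QuadraticRelations F Q) (n : ℕ)
    (hA : S.IsKoszulComplexCalabiYau n) (M : ModuleCat.{u} S.Env) (p : ℤ) :
    Nonempty (S.koszulCohomology M p ≃ₗ[F] S.koszulHomology M (n - p)) := by
  obtain ⟨h⟩ := hA.nonempty_homotopyEquiv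
  obtain ⟨e⟩ := h.nonempty_homology_iso_of_shift (S.tensorFunctor M) (-n) p (-(n - p)) (by omega)
  let c := ContravariantComplex.mapIso S.dualFunctor (S.tensorFunctor M)
    ((linearYoneda F (ModuleCat.{u} S.Env)).obj M) S.K (fun i => S.evalIso M (S.K.X i))
    fun i j => S.evalIso_naturality M (S.K.d i j)
  exact ⟨(((HomologicalComplex.homologyFunctor _ _ p).mapIso c).symm ≪≫ e).toLinearEquiv⟩
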